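/- Let $X$ be a finite set with at least two elements, let $X^*$ be the rooted tree of finite words over $X$ (the children of $v$ are the words $vx$, $x\in X$), and let $X^\omega$ be the set of its ends, i.e. of infinite words. For $g\in\mathrm{Aut}(X^*)$ and $v\in X^*$ let $g|_v\in\mathrm{Aut}(X^*)$ be the restriction, defined by $g(vw)=g(v)\,g|_v(w)$ for all $w \in X^*$. For $G\le\mathrm{Aut}(X^*)$ let $G_n$ be the image of $G$ in $\mathrm{Sym}(X^n)$ and put $$\mathcal F(G)=\lim_{n\to\infty}\frac{\#\{g\in G_n : g \text{ fixes at least one element of } X^n\}}{\#G_n}.$$ Let $A$ be a finite invertible automaton over $X$: a finite set of states, each state $a$ acting on $X$ by a permutation $x\mapsto a(x)$ and having for each $x\in X$ a next state $a|_x\in A$. For a word $v=x_1\cdots x_n$ let $a|_v=(\cdots(a|_{x_1})|_{x_2}\cdots)|_{x_n}$ be the state reached from $a$ after reading $v$. Each state $a$ defines an element of $\mathrm{Aut}(X^*)$, again denoted $a$, by $a(xw)=a(x)\,a|_x(w)$; the state is called trivial if this element is the identity. Let $G=\langle A\rangle\le\mathrm{Aut}(X^*)$ be the subgroup generated by the states.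 Suppose that: 1. for each non-trivial $a\in A$ there is a unique pair $(b,x)\in A\times X$ with $b|_x=a$; 2. for each $a\in A$ and each cycle (fixed points included) of the action of $a$ on $X$, the restriction $a|_x$ is non-trivial for at most one $x$ in the cycle; 3. the multi-set of permutations of $X$ defined by the states of $A$ is tree-like, i.e. its cycle diagram is contractible; equivalently, the bipartite graph with white vertices the elements of $X$, with one black vertex for each pair of a state $a$ and a cycle of length at least $2$ of the action of $a$ on $X$, and with each black vertex joined to the elements of $X$ on its cycle, is a tree; 4. if $a_1\ne a_2$ are non-trivial states and $v_1,v_2\in X^*$ are non-empty words with $a_i|_{v_i}=a_i$ and $a_i(v_i)=v_i$ for $i=1,2$, then there is no $h\in G$ with $h(v_1)=v_2$ and $h|_{v_1}=h$. The reduced Moore diagram of $A$ is the directed graph whose vertices are the non-trivial states, with an arrow from $a$ to $a|_x$ for each $x\in X$ for which $a|_x$ is non-trivial. If every state of $A$ lying in a (directed) cycle of the reduced Moore diagram fixes either no ends of $X^*$ or infinitely many ends of $X^*$, then $\mathcal F(G)=0$. -/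

import Mathlib

/-! ### Automorphisms of the rooted tree of words -/

/-- The group of automorphisms of the rooted tree `X^*` of finite words over `X` (the root is the
empty word, the children of `v` are the words `vx`): the bijections of the set of words that
preserve length and preserve and reflect the prefix (ancestor) relation.
The group law is composition, and the action is on the left. -/
def TreeAut (X : Type*) : Subgroup (Equiv.Perm (List X)) where
  carrier := {g | (∀ v, (g v).length = v.length) ∧ ∀ u v, g u <+: g v ↔ u <+: v}
  one_mem' := by simp
  mul_mem' := by
    rintro g h ⟨hg, hg'⟩ ⟨hh, hh'⟩
    exact ⟨fun v => by simp [hg, hh], fun u v => by simp [hg', hh']⟩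
  inv_mem' := by
    rintro g ⟨hg, hg'⟩
    exact ⟨fun v => by simpa using (hg (g⁻¹ v)).symm,
      fun u v => by simpa using (hg' (g⁻¹ u) (g⁻¹ v)).symm⟩

namespace TreeAut

variable {X : Type*}

theorem length_apply (g : TreeAut X) (v : List X) : (g.1 v).length = v.length := g.2.1 v

theorem prefix_iff (g : TreeAut X) (u v : List X) : g.1 u <+: g.1 v ↔ u <+: v := g.2.2 u v

theorem apply_append (g : TreeAut X) (v w : List X) :
    g.1 (v ++ w) = g.1 v ++ (g.1 (v ++ w)).drop v.length := by
  obtain ⟨t, ht⟩ := (prefix_iff g v (v ++ w)).2 (List.prefix_append v w)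
  rw [← ht, ← length_apply g v, List.drop_left]

theorem inv_apply_append (g : TreeAut X) (v w : List X) :
    (g⁻¹).1 (g.1 v ++ w) = v ++ ((g⁻¹).1 (g.1 v ++ w)).drop v.length := by
  have h := apply_append g⁻¹ (g.1 v) w
  rw [length_apply] at h
  simpa using h

/-- The restriction `g|_v`, the automorphism characterised by `g (v w) = g v (g|_v w)`. -/
def restrict (g : TreeAut X) (v : List X) : TreeAut X :=
  ⟨{ toFun := fun w => (g.1 (v ++ w)).drop v.length
     invFun := fun w => ((g⁻¹).1 (g.1 v ++ w)).drop v.length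
     left_inv := fun w => by
      simp only
      rw [← apply_append]
      simp
     right_inv := fun w => by
      simp only
      rw [← inv_apply_append]
      simp [← length_apply g v] },
    fun w => by simp [length_apply],
    fun u w => by
      have h := prefix_iff g (v ++ u) (v ++ w)
      rw [apply_append g v u, apply_append g v w, List.prefix_append_right_inj,
        List.prefix_append_right_inj] at h
      exact h⟩

theorem apply_append_restrict (g : TreeAut X) (v w : List X) :
    g.1 (v ++ w) = g.1 v ++ (restrict g v).1 w := apply_append g v w

/-- The action of `Aut(X^*)` on the level `X^n`, the set of words of length `n`. -/
def levelAction (X : Type*) (n : ℕ) : TreeAut X →* Equiv.Perm {v : List X // v.length = n} where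
  toFun g := g.1.subtypeEquiv fun v => by rw [length_apply]
  map_one' := by ext; simp
  map_mul' g h := by ext; simp

/-- The ends of `X^*` fixed by `g`. An end is an infinite word `x_0 x_1 x_2 ⋯`, that is, the
infinite path from the root through its initial words, and it is fixed by `g` if and only if each of
these vertices is. -/
def fixedEnds (g : TreeAut X) : Set (ℕ → X) :=
  {e | ∀ n : ℕ, g.1 (List.ofFn fun i : Fin n => e i) = List.ofFn fun i : Fin n => e i}

/-- For a subgroup `G` of `Aut(X^*)`, with image `G_n` in the symmetric group of `X^n`: the
proportion of the elements of `G_n` that fix at least one element of `X^n`. -/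
noncomputable def fixedPointProportion (G : Subgroup (TreeAut X)) (n : ℕ) : ℝ :=
  (Nat.card {g : G.map (levelAction X n) // ∃ v, g.1 v = v} : ℝ) /
    (Nat.card (G.map (levelAction X n)) : ℝ)

end TreeAut

/-! ### Tree-like multi-sets of permutations -/

section TreeLike

variable {I X : Type*} [Fintype X] [DecidableEq X]

/-- The black vertices of the cycle graph of the multi-set `i ↦ π i` of permutations: the pairs of
an index `i` and a cycle, of length at least two, of `π i`. -/
abbrev NontrivialCycle (π : I → Equiv.Perm X) : Type _ :=
  {p : I × Equiv.Perm X // p.2 ∈ (π p.1).cycleFactorsFinset}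

/-- The cycle graph of a multi-set of permutations of `X`: the bipartite graph with the elements of
`X` as white vertices and the nontrivial cycles of the permutations, counted with the index, as black
vertices, each joined to the elements of `X` that lie on it. -/
def cycleGraph (π : I → Equiv.Perm X) : SimpleGraph (X ⊕ NontrivialCycle π) :=
  SimpleGraph.fromRel fun u v =>
    ∃ (x : X) (c : NontrivialCycle π), u = Sum.inl x ∧ v = Sum.inr c ∧ x ∈ c.1.2.support

/-- A multi-set of permutations is tree-like if its cycle diagram is contractible, that is, if its
cycle graph, onto which the cycle diagram deformation retracts, is a tree. -/
def IsTreeLike (π : I → Equiv.Perm X) : Prop := (cycleGraph π).IsTree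

end TreeLike

/-! ### Automata -/

/-- An invertible automaton with set of states `S` over the alphabet `X`: in the state `a`, on input
`x`, it outputs `perm a x` and goes to the state `next a x`. Invertible means that each state acts on
`X` as a permutation. -/
structure InvertibleAutomaton (S X : Type*) where
  perm : S → Equiv.Perm X
  next : S → X → S

namespace InvertibleAutomaton

variable {S X : Type*} (A : InvertibleAutomaton S X)

/-- The state `a|_v` reached from the state `a` after reading the word `v`. -/
def run (a : S) (v : List X) : S := v.foldl A.next a

/-- The output word of the automaton started in the state `a` on an input word. -/
def act : S → List X → List X
  | _, [] => []
  | a, x :: w => A.perm a x :: act (A.next a x) w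

/-- The inverse of the transformation `act`. -/
def actInv : S → List X → List X
  | _, [] => []
  | a, y :: w => (A.perm a).symm y :: actInv (A.next a ((A.perm a).symm y)) w

theorem actInv_act (a : S) (v : List X) : A.actInv a (A.act a v) = v := by
  induction v generalizing a with
  | nil => rfl
  | cons x w ih => simp [act, actInv, ih]

theorem act_actInv (a : S) (v : List X) : A.act a (A.actInv a v) = v := by
  induction v generalizing a with
  | nil => rfl
  | cons x w ih => simp [act, actInv, ih]

theorem length_act (a : S) (v : List X) : (A.act a v).length = v.length := by
  induction v generalizing a with
  | nil => rfl
  | cons x w ih => simp [act, ih]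

theorem act_prefix_iff (a : S) (u v : List X) : A.act a u <+: A.act a v ↔ u <+: v := by
  induction u generalizing a v with
  | nil => simp [act]
  | cons x u ih =>
    cases v with
    | nil => simp [act]
    | cons y v =>
      simp only [act, List.cons_prefix_cons, EmbeddingLike.apply_eq_iff_eq]
      constructor
      · rintro ⟨rfl, h⟩
        exact ⟨rfl, (ih _ _).1 h⟩
      · rintro ⟨rfl, h⟩
        exact ⟨rfl, (ih _ _).2 h⟩

/-- The automorphism of `X^*` defined by a state. -/
def toAut (a : S) : TreeAut X :=
  ⟨{ toFun := A.act a
     invFun := A.actInv a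
     left_inv := A.actInv_act a
     right_inv := A.act_actInv a }, A.length_act a, A.act_prefix_iff a⟩

/-- The subgroup `⟨A⟩` of `Aut(X^*)` generated by the states of the automaton. -/
def group : Subgroup (TreeAut X) := Subgroup.closure (Set.range A.toAut)

/-- The non-trivial states: those that do not define the identity of `X^*`. -/
abbrev NontrivialState : Type _ := {a : S // A.toAut a ≠ 1}

/-- There is an arrow from `a` to `b` in the reduced Moore diagram, whose vertices are the
non-trivial states. -/
def ReducedArrow (a b : A.NontrivialState) : Prop := ∃ x : X, A.next a.1 x = b.1

/-- The non-trivial state `a` lies in a (directed) cycle of the reduced Moore diagram. -/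
def InReducedCycle (a : A.NontrivialState) : Prop := Relation.TransGen A.ReducedArrow a a

/-- The automaton is a kneading automaton without bad isotropy:
* there is a unique arrow of the Moore diagram into each non-trivial state;
* on each cycle (fixed points included) of the action of a state `a` on `X` there is at most one
  letter at which the restriction of `a` is non-trivial;
* the multi-set of the permutations of `X` given by the states is tree-like;
* if `a₁ ≠ a₂` are non-trivial states and `v₁`, `v₂` are non-empty words with `a_i|_{v_i} = a_i` and
  `a_i(v_i) = v_i`, then no `h` in `⟨A⟩` satisfies `h(v₁) = v₂` and `h|_{v₁} = h`. -/
structure IsPolynomialLike [Fintype X] [DecidableEq X] : Prop where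
  unique_arrow : ∀ a : A.NontrivialState, ∃! p : S × X, A.next p.1 p.2 = a.1
  cycle_restrict : ∀ (a : S) (x y : X), (A.perm a).SameCycle x y →
    A.toAut (A.next a x) ≠ 1 → A.toAut (A.next a y) ≠ 1 → x = y
  treeLike : IsTreeLike A.perm
  isotropy : ∀ a₁ a₂ : A.NontrivialState, a₁ ≠ a₂ → ∀ v₁ v₂ : List X, v₁ ≠ [] → v₂ ≠ [] →
    A.run a₁.1 v₁ = a₁.1 → (A.toAut a₁.1).1 v₁ = v₁ →
    A.run a₂.1 v₂ = a₂.1 → (A.toAut a₂.1).1 v₂ = v₂ →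
    ¬ ∃ h ∈ A.group, h.1 v₁ = v₂ ∧ TreeAut.restrict h v₁ = h

end InvertibleAutomaton

/-!
Write `G` for the group of the automaton and `d` for the number of letters. The proportion of the
elements of `G` with a fixed vertex of level `n` decreases with `n`. If its limit is a number `F > 0`,
a contradiction arises as follows.

*Linear algebra on a tree.* Call a function on a finite set balanced for a permutation if its sum
over each orbit is zero. For a tree-like multi-set of permutations the spaces of balanced functions
are linearly independent, since every edge of a tree is a bridge
(`IsTreeLike.independentOrbits`). By the conditions on the Moore diagram, independence passes from
each level to the next one (`independentOrbits_level`). It has two consequences: the product of the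
non-trivial states in any order is transitive, by telescoping (`IsTreeLike.exists_prod_pow_eq`), and,
by a dimension count, at most one state acts on a given level without fixed points
(`IndependentOrbits.eq_of_forall_ne`).

*Generation.* Let `c` be a state whose restrictions at all vertices fixed by `c` are non-trivial. Then
`c` fixes no vertex of high level (`exists_level_forall_ne`). Otherwise, by compactness, it fixes an
end. All its restrictions along its fixed ends are non-trivial, so that `c` lies in a cycle of the
reduced Moore diagram and there is only one such end, contrary to the hypothesis on the states in
cycles. Hence there is at most one such state `c`, and a subgroup that contains all elements fixing
some vertex with trivial restriction there, and the product of the non-trivial states in one order, is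
`G` (`eq_top_of_forall_restrict_eq_one`).

*A transitive normal subgroup.* If `o` is the product of the states in some order, then the
restrictions of `o ^ d` at the letters are again such products. Choosing an order which recurs
periodically under this operation gives a normal subgroup `H` which contains such a product, is
transitive on all levels and reproduces itself as the group of restrictions, at any vertex, of its
elements that stabilise the level of the vertex (`exists_normal_transitive`).

*Probability.* Consider random elements of the finite quotients of `G`. Restrictions at fixed vertices
are equidistributed, as `G` is self-replicating, and the number of fixed vertices of level `n` is a
martingale, thanks to `H`. By strict convexity of `1 / (1 + x)` it is eventually constant on the part
where it is bounded (`tendsto_prob_fixCount_ne`). Let `R > 1 / F` and let `Y m` be the set of the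
`g` such that no element of the coset `g H` has more than `R` fixed vertices on one of the levels up to
`m`. Restricting a random element with a fixed vertex of very high level to this vertex shows that
`Y m` has probability at least `F - 1 / R > 0` (`sub_inv_le_prob_fewFixed`). These probabilities
decrease with `m`, so they converge, and from this it follows that `Y m` is nearly invariant under
right multiplication by an element fixing a vertex with trivial restriction there
(`prob_fewFixed_and_not_le`). As `Y m` is invariant under `H`, it is nearly invariant under `G`, by
the generation statement. But each element has a translate, by one of finitely many elements, in the
stabiliser of a level with more than `R` vertices, hence outside `Y m`. So the probability of `Y m`
tends to zero (`tendsto_prob_fewFixed`), a contradiction.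
-/

/-! ### Fixed vertices of automorphisms of the tree -/

namespace TreeAut

variable {X : Type*}

theorem ext_apply {g h : TreeAut X} (H : ∀ v, g.1 v = h.1 v) : g = h :=
  Subtype.ext (Equiv.ext H)

@[simp] theorem mul_apply (g h : TreeAut X) (v : List X) : (g * h).1 v = g.1 (h.1 v) := rfl

@[simp] theorem one_apply (v : List X) : (1 : TreeAut X).1 v = v := rfl

@[simp] theorem apply_nil (g : TreeAut X) : g.1 [] = [] :=
  List.length_eq_zero_iff.1 (by simp [length_apply])

theorem inv_apply_eq {g : TreeAut X} {v w : List X} : (g⁻¹).1 v = w ↔ v = g.1 w := by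
  rw [show (g⁻¹).1 = g.1⁻¹ from rfl]
  exact Equiv.Perm.inv_eq_iff_eq

theorem restrict_apply_eq {g : TreeAut X} {v w t : List X} (h : g.1 (v ++ w) = g.1 v ++ t) :
    (restrict g v).1 w = t :=
  List.append_cancel_left ((apply_append_restrict g v w).symm.trans h)

@[simp] theorem restrict_one (v : List X) : restrict (1 : TreeAut X) v = 1 :=
  ext_apply fun _ => restrict_apply_eq rfl

theorem restrict_mul (g h : TreeAut X) (v : List X) :
    restrict (g * h) v = restrict g (h.1 v) * restrict h v :=
  ext_apply fun w => restrict_apply_eq (by simp [apply_append_restrict])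

@[simp] theorem restrict_nil (g : TreeAut X) : restrict g [] = g :=
  ext_apply fun w => restrict_apply_eq (by simp)

theorem restrict_append (g : TreeAut X) (v w : List X) :
    restrict g (v ++ w) = restrict (restrict g v) w :=
  ext_apply fun t => restrict_apply_eq (by
    rw [List.append_assoc, apply_append_restrict, apply_append_restrict, apply_append_restrict g v w,
      List.append_assoc])

theorem restrict_cons (g : TreeAut X) (x : X) (w : List X) :
    restrict g (x :: w) = restrict (restrict g [x]) w := restrict_append g [x] w

theorem apply_cons (g : TreeAut X) (x : X) (w : List X) :
    g.1 (x :: w) = g.1 [x] ++ (restrict g [x]).1 w := apply_append_restrict g [x] w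

theorem restrict_inv (g : TreeAut X) (v : List X) :
    restrict g⁻¹ (g.1 v) = (restrict g v)⁻¹ := by
  rw [eq_inv_iff_mul_eq_one, ← restrict_mul, inv_mul_cancel, restrict_one]

theorem pow_apply_of_fixed {g : TreeAut X} {v : List X} (h : g.1 v = v) (k : ℕ) :
    (g ^ k).1 v = v := by
  induction k with
  | zero => simp
  | succ k ih => rw [pow_succ, mul_apply, h, ih]

theorem restrict_pow_of_fixed {g : TreeAut X} {v : List X} (h : g.1 v = v) (k : ℕ) :
    restrict (g ^ k) v = restrict g v ^ k := by
  induction k with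
  | zero => simp
  | succ k ih => rw [pow_succ, restrict_mul, h, ih, pow_succ]

/-- An element fixing a word fixes each of its initial words. -/
theorem fixed_of_append {g : TreeAut X} {v w : List X} (h : g.1 (v ++ w) = v ++ w) :
    g.1 v = v ∧ (restrict g v).1 w = w := by
  rw [apply_append_restrict] at h
  exact List.append_inj h (length_apply g v)

theorem fixed_append_iff {g : TreeAut X} {v w : List X} :
    g.1 (v ++ w) = v ++ w ↔ g.1 v = v ∧ (restrict g v).1 w = w := by
  refine ⟨fixed_of_append, fun ⟨h, h'⟩ => ?_⟩
  rw [apply_append_restrict, h, h']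

/-- The stabiliser of the level `X^n`. -/
def levelStab (X : Type*) (n : ℕ) : Subgroup (TreeAut X) := (levelAction X n).ker

theorem mem_levelStab {n : ℕ} {g : TreeAut X} :
    g ∈ levelStab X n ↔ ∀ v : List X, v.length = n → g.1 v = v := by
  rw [levelStab, MonoidHom.mem_ker, Equiv.ext_iff]
  constructor
  · intro h v hv
    exact congrArg Subtype.val (h ⟨v, hv⟩)
  · intro h v
    exact Subtype.ext (h v.1 v.2)

instance (n : ℕ) : (levelStab X n).Normal := by unfold levelStab; infer_instance

theorem levelStab_antitone : Antitone (levelStab X) := by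
  intro m n hmn g hg
  rw [mem_levelStab] at hg ⊢
  intro v hv
  rcases v with _ | ⟨x, v⟩
  · simp
  · refine (fixed_of_append (w := List.replicate (n - m) x) (hg _ ?_)).1
    simp only [List.length_append, List.length_replicate]
    omega

/-- The words of length `n` form a finite type. -/
abbrev Word (X : Type*) (n : ℕ) : Type _ := {v : List X // v.length = n}

instance Word.fintype [Fintype X] (n : ℕ) : Fintype (Word X n) :=
  inferInstanceAs (Fintype (List.Vector X n))

theorem Word.card [Fintype X] (n : ℕ) : Fintype.card (Word X n) = Fintype.card X ^ n :=
  card_vector n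

/-- Concatenation of words of fixed lengths. -/
def Word.append {m n : ℕ} (v : Word X m) (w : Word X n) : Word X (m + n) :=
  ⟨v.1 ++ w.1, by simp [v.2, w.2]⟩

/-- A word of length `m + n` is a word of length `m` followed by a word of length `n`. -/
def Word.appendEquiv (X : Type*) (m n : ℕ) : Word X m × Word X n ≃ Word X (m + n) where
  toFun p := p.1.append p.2
  invFun u := (⟨u.1.take m, by simp [u.2]⟩, ⟨u.1.drop m, by simp [u.2]⟩)
  left_inv := by
    rintro ⟨⟨v, rfl⟩, w⟩
    simp [Word.append]
  right_inv u := by simp [Word.append]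

/-- A word of length `n + 1` is a letter followed by a word of length `n`. -/
def Word.consEquiv (X : Type*) (n : ℕ) : X × Word X n ≃ Word X (n + 1) where
  toFun p := ⟨p.1 :: p.2.1, by simp [p.2.2]⟩
  invFun u := (u.1.head (by rintro h; simpa [h] using u.2), ⟨u.1.tail, by simp [u.2]⟩)
  left_inv := by
    rintro ⟨x, w⟩
    simp
  right_inv u := by simp

open Classical in
/-- The number of words of length `n` fixed by `g`. -/
noncomputable def fixCount [Fintype X] (n : ℕ) (g : TreeAut X) : ℕ :=
  (Finset.univ.filter fun v : Word X n => g.1 v.1 = v.1).card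

variable [Fintype X]

theorem fixCount_pos_iff {n : ℕ} {g : TreeAut X} :
    0 < fixCount n g ↔ ∃ v : Word X n, g.1 v.1 = v.1 := by
  classical
  simp [fixCount, Finset.card_pos, Finset.Nonempty]

theorem fixCount_of_mem_levelStab {n : ℕ} {g : TreeAut X} (hg : g ∈ levelStab X n) :
    fixCount n g = Fintype.card X ^ n := by
  classical
  rw [← Word.card, fixCount, Finset.filter_true_of_mem, Finset.card_univ]
  exact fun v _ => mem_levelStab.1 hg v.1 v.2

theorem fixCount_mul_of_mem_levelStab {n : ℕ} (g : TreeAut X) {s : TreeAut X}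
    (hs : s ∈ levelStab X n) : fixCount n (g * s) = fixCount n g := by
  classical
  unfold fixCount
  congr 1
  ext v
  rw [Finset.mem_filter, Finset.mem_filter, mul_apply, mem_levelStab.1 hs v.1 v.2]

/-- The fixed words below a fixed word `v` correspond to the words fixed by the restriction. -/
theorem fixCount_restrict_le {g : TreeAut X} {v : List X} (hv : g.1 v = v) (j : ℕ) :
    fixCount j (restrict g v) ≤ fixCount (v.length + j) g := by
  classical
  unfold fixCount
  refine Finset.card_le_card_of_injOn (fun w => Word.append ⟨v, rfl⟩ w) ?_ ?_
  · intro w hw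
    simp only [Finset.coe_filter, Finset.mem_univ, true_and, Set.mem_ofPred_eq] at hw ⊢
    exact fixed_append_iff.2 ⟨hv, hw⟩
  · intro w _ w' _ h
    have := congrArg Subtype.val h
    exact Subtype.ext (List.append_cancel_left this)

end TreeAut

/-! ### Balanced functions and tree-like multi-sets of permutations -/

section OrbitBalanced

variable {I α : Type*} [Fintype α]

/-- A function is balanced for a permutation `σ` if it is orthogonal to the functions that are
constant on the orbits of `σ`, that is, if its sum over each orbit of `σ` is zero. -/
def OrbitBalanced (σ : Equiv.Perm α) (r : α → ℚ) : Prop :=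
  ∀ f : α → ℚ, (∀ x, f (σ x) = f x) → ∑ x, r x * f x = 0

/-- The spaces of balanced functions for the permutations `π i` are linearly independent. -/
def IndependentOrbits [Fintype I] (π : I → Equiv.Perm α) : Prop :=
  ∀ r : I → α → ℚ, (∀ i, OrbitBalanced (π i) (r i)) → (∀ x, ∑ i, r i x = 0) → ∀ i x, r i x = 0

theorem OrbitBalanced.eq_zero_of_apply_eq {σ : Equiv.Perm α} {r : α → ℚ} (h : OrbitBalanced σ r) {x : α}
    (hx : σ x = x) : r x = 0 := by
  classical
  have := h (fun y => if y = x then 1 else 0) fun y => by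
    have : σ y = x ↔ y = x := by
      rw [← σ.injective.eq_iff (a := y) (b := x), hx]
    simp [this]
  simpa using this

theorem orbitBalanced_zero (σ : Equiv.Perm α) : OrbitBalanced σ fun _ => 0 := fun f _ => by simp

theorem OrbitBalanced.add {σ : Equiv.Perm α} {r s : α → ℚ} (hr : OrbitBalanced σ r) (hs : OrbitBalanced σ s) :
    OrbitBalanced σ fun x => r x + s x := fun f hf => by
  simp [add_mul, Finset.sum_add_distrib, hr f hf, hs f hf]

theorem OrbitBalanced.neg {σ : Equiv.Perm α} {r : α → ℚ} (hr : OrbitBalanced σ r) :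
    OrbitBalanced σ fun x => -r x := fun f hf => by
  simp [hr f hf]

theorem orbitBalanced_comp_sub (σ : Equiv.Perm α) (g : α → ℚ) : OrbitBalanced σ fun x => g (σ x) - g x := by
  intro f hf
  have : ∑ x, g (σ x) * f (σ x) = ∑ x, g x * f x := Equiv.sum_comp σ fun x => g x * f x
  simp only [hf] at this
  simp [sub_mul, this]

theorem eq_of_sameCycle {β : Type*} {σ : Equiv.Perm α} {f : α → β} (hf : ∀ x, f (σ x) = f x)
    {x y : α} (h : σ.SameCycle x y) : f x = f y := by
  obtain ⟨i, rfl⟩ := h.exists_nat_pow_eq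
  clear h
  induction i with
  | zero => simp
  | succ i ih => rw [pow_succ', Equiv.Perm.mul_apply, hf, ← ih]

open Classical in
/-- It suffices to test balancedness on the indicator functions of the orbits. -/
theorem orbitBalanced_of_sum_sameCycle {σ : Equiv.Perm α} {r : α → ℚ}
    (h : ∀ x, ∑ y with σ.SameCycle y x, r y = 0) : OrbitBalanced σ r := by
  intro f hf
  refine Finset.sum_cancels_of_partition_cancels (Equiv.Perm.SameCycle.setoid σ) ?_
  intro x _
  have : ∀ y ∈ Finset.univ.filter (fun y => σ.SameCycle y x), r y * f y = r y * f x := by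
    intro y hy
    rw [eq_of_sameCycle hf (Finset.mem_filter.1 hy).2]
  refine (Finset.sum_congr (by ext; simp; rfl) this).trans ?_
  rw [← Finset.sum_mul, h x, zero_mul]

theorem card_quotient_sameCycle_le {σ : Equiv.Perm α} (hσ : ∀ x, σ x ≠ x)
    [Fintype (Quotient (Equiv.Perm.SameCycle.setoid σ))] :
    2 * Fintype.card (Quotient (Equiv.Perm.SameCycle.setoid σ)) ≤ Fintype.card α := by
  classical
  rw [← Finset.card_univ (α := α),
    Finset.card_eq_sum_card_fiberwise
      (f := fun x => (Quotient.mk (Equiv.Perm.SameCycle.setoid σ) x)) (t := Finset.univ)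
      (fun _ _ => Finset.mem_coe.2 (Finset.mem_univ _)), mul_comm, ← smul_eq_mul,
    ← Finset.card_univ]
  refine Finset.card_nsmul_le_sum _ _ _ fun q _ => ?_
  induction q using Quotient.inductionOn with
  | _ x =>
    rw [← Finset.card_pair (hσ x)]
    refine Finset.card_le_card ?_
    intro y hy
    rw [Finset.mem_insert, Finset.mem_singleton] at hy
    rw [Finset.mem_filter]
    refine ⟨Finset.mem_univ _, Quotient.sound ?_⟩
    rcases hy with rfl | rfl
    · exact Equiv.Perm.sameCycle_apply_left.2 (Equiv.Perm.SameCycle.refl _ _)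
    · exact Equiv.Perm.SameCycle.refl _ _

open Classical in
/-- Two permutations without fixed points have at most as many orbits as there are points; as the
sums over the orbits of either add up to the same total, there is a nonzero function that is
balanced for both. -/
theorem exists_orbitBalanced_of_forall_ne [Nonempty α] {σ τ : Equiv.Perm α} (hσ : ∀ x, σ x ≠ x)
    (hτ : ∀ x, τ x ≠ x) : ∃ r : α → ℚ, r ≠ 0 ∧ OrbitBalanced σ r ∧ OrbitBalanced τ r := by
  let Q := Quotient (Equiv.Perm.SameCycle.setoid σ)
  let P := Quotient (Equiv.Perm.SameCycle.setoid τ)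
  let p₀ : P := Quotient.mk _ (Classical.arbitrary α)
  let φ : (α → ℚ) →ₗ[ℚ] (Q → ℚ) × ({p : P // p ≠ p₀} → ℚ) :=
    { toFun := fun r => (fun q => ∑ y with Quotient.mk _ y = q, r y,
        fun p => ∑ y with Quotient.mk _ y = p.1, r y)
      map_add' := fun r s => by
        ext <;> simp [Finset.sum_add_distrib]
      map_smul' := fun c r => by
        ext <;> simp [Finset.mul_sum] }
  have hlt : Module.finrank ℚ ((Q → ℚ) × ({p : P // p ≠ p₀} → ℚ)) < Module.finrank ℚ (α → ℚ) := by
    have h1 := card_quotient_sameCycle_le hσ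
    have h2 := card_quotient_sameCycle_le hτ
    have h3 : Fintype.card {p : P // p ≠ p₀} = Fintype.card P - 1 :=
      Set.card_ne_eq p₀
    have h4 : 0 < Fintype.card P := Fintype.card_pos_iff.2 ⟨p₀⟩
    simp only [Module.finrank_prod, Module.finrank_fintype_fun_eq_card, h3]
    change 2 * Fintype.card Q ≤ _ at h1
    change 2 * Fintype.card P ≤ _ at h2
    omega
  obtain ⟨r, hr, hr0⟩ := (Submodule.ne_bot_iff _).1 (LinearMap.ker_ne_bot_of_finrank_lt (f := φ) hlt)
  have hr' := Prod.ext_iff.1 (show φ r = 0 from LinearMap.mem_ker.1 hr)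
  have hQ : ∀ q : Q, ∑ y with Quotient.mk _ y = q, r y = 0 := fun q => congrFun hr'.1 q
  have hP : ∀ p : P, p ≠ p₀ → ∑ y with Quotient.mk _ y = p, r y = 0 :=
    fun p hp => congrFun hr'.2 ⟨p, hp⟩
  have htot : ∑ y, r y = 0 := by
    rw [← Finset.sum_fiberwise Finset.univ (fun y => (Quotient.mk _ y : Q)) r]
    exact Finset.sum_eq_zero fun q _ => hQ q
  have hP₀ : ∑ y with (Quotient.mk _ y : P) = p₀, r y = 0 := by
    rw [← Finset.sum_fiberwise Finset.univ (fun y => (Quotient.mk _ y : P)) r,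
      Finset.sum_eq_single p₀ (fun p _ hp => hP p hp) (by simp)] at htot
    exact htot
  refine ⟨r, hr0, orbitBalanced_of_sum_sameCycle fun x => ?_, orbitBalanced_of_sum_sameCycle fun x => ?_⟩
  · rw [← hQ (Quotient.mk _ x)]
    refine Finset.sum_congr (Finset.filter_congr fun y _ => ?_) fun _ _ => rfl
    exact (Quotient.eq (r := Equiv.Perm.SameCycle.setoid σ)).symm
  · have : ∑ y with (Quotient.mk _ y : P) = Quotient.mk _ x, r y = 0 := by
      by_cases h : (Quotient.mk _ x : P) = p₀
      · rw [h]; exact hP₀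
      · exact hP _ h
    rw [← this]
    refine Finset.sum_congr (Finset.filter_congr fun y _ => ?_) fun _ _ => rfl
    exact (Quotient.eq (r := Equiv.Perm.SameCycle.setoid τ)).symm

namespace IndependentOrbits

variable [Fintype I] {π : I → Equiv.Perm α}

/-- At most one of the permutations of an independent family has no fixed points. -/
theorem eq_of_forall_ne [Nonempty α] (h : IndependentOrbits π) {i j : I} (hi : ∀ x, π i x ≠ x)
    (hj : ∀ x, π j x ≠ x) : i = j := by
  classical
  by_contra hij
  obtain ⟨r, hr0, hri, hrj⟩ := exists_orbitBalanced_of_forall_ne hi hj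
  refine hr0 (funext fun x => ?_)
  have := h (fun k x => if k = i then r x else if k = j then -r x else 0) (fun k => ?_) (fun x => ?_)
    i x
  · simpa using this
  · by_cases hki : k = i
    · subst hki; simpa using hri
    · by_cases hkj : k = j
      · subst hkj; simpa [hki] using hrj.neg
      · simpa [hki, hkj] using orbitBalanced_zero _
  · have : ∀ k, (if k = i then r x else if k = j then -r x else 0)
        = (if k = i then r x else 0) + if k = j then -r x else 0 := by
      intro k
      by_cases hki : k = i
      · subst hki; simp [hij]
      · simp [hki]
    simp [this, Finset.sum_add_distrib]

/-- Telescoping: `f ∘ (π₁ ⋯ πₖ) - f` is the sum of the differences `gᵢ ∘ πᵢ - gᵢ` with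
`gᵢ = f ∘ π₁ ⋯ πᵢ₋₁`, and `gᵢ ∘ πᵢ - gᵢ` is balanced for `πᵢ`. -/
theorem exists_telescope (π : I → Equiv.Perm α) (l : List I) (hl : l.Nodup) (f : α → ℚ) :
    ∃ r : I → α → ℚ, (∀ i, OrbitBalanced (π i) (r i)) ∧ (∀ i ∉ l, ∀ x, r i x = 0) ∧
      (∀ x, ∑ i, r i x = f ((l.map π).prod x) - f x) ∧
      ((∀ i x, r i x = 0) → ∀ i ∈ l, ∀ x, f (π i x) = f x) := by
  classical
  induction l generalizing f with
  | nil => exact ⟨fun _ _ => 0, fun i => orbitBalanced_zero _, by simp, by simp, by simp⟩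
  | cons a l ih =>
    rw [List.nodup_cons] at hl
    obtain ⟨r, hr, hr0, hsum, hinv⟩ := ih hl.2 fun x => f (π a x)
    refine ⟨fun i x => r i x + if i = a then f (π a x) - f x else 0, fun i => ?_, ?_, fun x => ?_, ?_⟩
    · refine (hr i).add ?_
      by_cases hi : i = a
      · subst hi; simpa using orbitBalanced_comp_sub _ f
      · simpa [hi] using orbitBalanced_zero _
    · intro i hi x
      simp only [List.mem_cons, not_or] at hi
      simp [hr0 i hi.2, hi.1]
    · simp [Finset.sum_add_distrib, hsum]
    · intro h
      have ha : ∀ x, f (π a x) = f x := fun x => by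
        have := h a x
        simp only [hr0 a hl.1, if_true, zero_add] at this
        linarith
      have hr' : ∀ i x, r i x = 0 := fun i x => by
        have := h i x
        simpa [ha] using this
      intro i hi x
      rcases List.mem_cons.1 hi with rfl | hi
      · exact ha x
      · simpa [ha] using hinv hr' i hi x

theorem invariant_of_prod (h : IndependentOrbits π) {l : List I} (hl : l.Nodup) {f : α → ℚ}
    (hf : ∀ x, f ((l.map π).prod x) = f x) : ∀ i ∈ l, ∀ x, f (π i x) = f x := by
  obtain ⟨r, hr, -, hsum, hinv⟩ := exists_telescope π l hl f
  exact hinv (h r hr fun x => by rw [hsum, hf, sub_self])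

end IndependentOrbits

end OrbitBalanced

namespace IsTreeLike

variable {I X : Type*} [Fintype X] [DecidableEq X] {π : I → Equiv.Perm X}

theorem _root_.cycleGraph_adj_iff {x : X} {c : NontrivialCycle π} :
    (cycleGraph π).Adj (Sum.inl x) (Sum.inr c) ↔ x ∈ c.1.2.support := by
  rw [cycleGraph, SimpleGraph.fromRel_adj]
  constructor
  · rintro ⟨-, ⟨y, b, h1, h2, h3⟩ | ⟨y, b, h1, -⟩⟩
    · rwa [Sum.inl_injective h1, Sum.inr_injective h2]
    · cases h1
  · exact fun h => ⟨Sum.inl_ne_inr, Or.inl ⟨x, c, rfl, rfl, h⟩⟩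

/-- A function that is constant on the orbits of each permutation of a tree-like multi-set is
constant. -/
theorem eq_of_invariant (h : IsTreeLike π) {β : Type*} {f : X → β}
    (hf : ∀ i x, f (π i x) = f x) (x y : X) : f x = f y := by
  have key : ∀ u v : X ⊕ NontrivialCycle π, (cycleGraph π).Reachable u v →
      (∀ b, Sum.elim (fun x => f x = b) (fun c => ∀ x ∈ c.1.2.support, f x = b) u →
        Sum.elim (fun x => f x = b) (fun c => ∀ x ∈ c.1.2.support, f x = b) v) := by
    rintro u v ⟨p⟩ b
    induction p with
    | nil => exact id
    | @cons u v w huv p ih =>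
      refine fun hu => ih ?_
      have hadj := huv
      rw [cycleGraph, SimpleGraph.fromRel_adj] at huv
      rcases huv with ⟨-, ⟨x, c, rfl, rfl, hx⟩ | ⟨x, c, rfl, rfl, hx⟩⟩
      · intro y hy
        rw [← (show f x = b from hu)]
        have hc := Equiv.Perm.mem_cycleFactorsFinset_iff.1 c.2
        obtain ⟨i, hi⟩ := hc.1.exists_pow_eq (Equiv.Perm.mem_support.1 hx) (Equiv.Perm.mem_support.1 hy)
        rw [← hi]
        clear hi
        induction i with
        | zero => simp
        | succ i ih =>
          rw [pow_succ', Equiv.Perm.mul_apply, hc.2 _ ((Equiv.Perm.pow_apply_mem_support).2 hx), hf, ih]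
      · exact hu x hx
  exact (key (Sum.inl x) (Sum.inl y) (h.1.preconnected _ _) (f x) rfl).symm

/-- The weights `r i x` on the edges of the cycle graph have sum zero at each vertex. As an edge of a
tree is a bridge, such a weight vanishes: sum it over the vertices on one side of the edge. -/
theorem independentOrbits [Fintype I] (h : IsTreeLike π) : IndependentOrbits π := by
  classical
  intro r hr hsum a₀ x₀
  by_contra hne
  have hx₀ : x₀ ∈ (π a₀).support := by
    rw [Equiv.Perm.mem_support]
    exact fun hx => hne ((hr a₀).eq_zero_of_apply_eq hx)
  let c₀ : NontrivialCycle π :=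
    ⟨(a₀, (π a₀).cycleOf x₀), Equiv.Perm.cycleOf_mem_cycleFactorsFinset_iff.2 hx₀⟩
  have hadj : (cycleGraph π).Adj (Sum.inl x₀) (Sum.inr c₀) :=
    cycleGraph_adj_iff.2 (Equiv.Perm.mem_support_cycleOf_iff.2 ⟨Equiv.Perm.SameCycle.refl _ _, hx₀⟩)
  have hbridge := SimpleGraph.isAcyclic_iff_forall_adj_isBridge.1 h.2 hadj
  rw [SimpleGraph.isBridge_iff] at hbridge
  set D := (cycleGraph π).deleteEdges {s(Sum.inl x₀, Sum.inr c₀)} with hD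
  let f : X → ℚ := fun x => if D.Reachable (Sum.inl x₀) (Sum.inl x) then 1 else 0
  let g : I → X → ℚ := fun a x =>
    if ∃ c : NontrivialCycle π, c.1.1 = a ∧ x ∈ c.1.2.support ∧
      D.Reachable (Sum.inl x₀) (Sum.inr c) then 1 else 0
  have hg : ∀ a x, g a (π a x) = g a x := by
    intro a x
    have : (∃ c : NontrivialCycle π, c.1.1 = a ∧ π a x ∈ c.1.2.support ∧
        D.Reachable (Sum.inl x₀) (Sum.inr c)) ↔ ∃ c : NontrivialCycle π, c.1.1 = a ∧
        x ∈ c.1.2.support ∧ D.Reachable (Sum.inl x₀) (Sum.inr c) := by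
      refine exists_congr fun c => and_congr_right ?_
      rintro rfl
      rw [Equiv.Perm.mem_cycleFactorsFinset_support c.2]
    simp only [g, this]
  -- for a point moved by `π a`, the value `g a x` is read off at the cycle through `x`
  have hgc : ∀ (c : NontrivialCycle π) (x : X), x ∈ c.1.2.support →
      g c.1.1 x = if D.Reachable (Sum.inl x₀) (Sum.inr c) then 1 else 0 := by
    intro c x hx
    have : (∃ c' : NontrivialCycle π, c'.1.1 = c.1.1 ∧ x ∈ c'.1.2.support ∧
        D.Reachable (Sum.inl x₀) (Sum.inr c')) ↔ D.Reachable (Sum.inl x₀) (Sum.inr c) := by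
      refine ⟨?_, fun h => ⟨c, rfl, hx, h⟩⟩
      rintro ⟨c', hc', hx', hr'⟩
      have h1 := Equiv.Perm.cycle_is_cycleOf hx c.2
      have h2 := Equiv.Perm.cycle_is_cycleOf hx' c'.2
      have : c' = c := Subtype.ext (Prod.ext hc' (by rw [h1, h2, hc']))
      rwa [← this]
    simp only [g, this]
  have hzero : ∑ a, ∑ x, r a x * (f x - g a x) = 0 := by
    simp only [mul_sub, Finset.sum_sub_distrib]
    rw [Finset.sum_comm]
    simp only [← Finset.sum_mul, hsum]
    simp [fun a => hr a (g a) (hg a)]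
  have hterm : ∀ a x, (a, x) ≠ (a₀, x₀) → r a x * (f x - g a x) = 0 := by
    intro a x hax
    by_cases hx : π a x = x
    · rw [(hr a).eq_zero_of_apply_eq hx, zero_mul]
    · have hx' : x ∈ (π a).support := Equiv.Perm.mem_support.2 hx
      let c : NontrivialCycle π :=
        ⟨(a, (π a).cycleOf x), Equiv.Perm.cycleOf_mem_cycleFactorsFinset_iff.2 hx'⟩
      have hxc : x ∈ c.1.2.support :=
        Equiv.Perm.mem_support_cycleOf_iff.2 ⟨Equiv.Perm.SameCycle.refl _ _, hx'⟩
      have hDadj : D.Adj (Sum.inl x) (Sum.inr c) := by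
        rw [hD, SimpleGraph.deleteEdges_adj]
        refine ⟨cycleGraph_adj_iff.2 hxc, ?_⟩
        rw [Set.mem_singleton_iff, Sym2.eq_iff]
        rintro (⟨h1, h2⟩ | ⟨h1, -⟩)
        · refine hax (Prod.ext ?_ (Sum.inl_injective h1))
          exact congrArg (fun c : NontrivialCycle π => c.1.1) (Sum.inr_injective h2)
        · cases h1
      have : D.Reachable (Sum.inl x₀) (Sum.inl x) ↔ D.Reachable (Sum.inl x₀) (Sum.inr c) :=
        ⟨fun h => h.trans hDadj.reachable, fun h => h.trans hDadj.symm.reachable⟩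
      have hgx := hgc c x hxc
      have : f x = g a x := by
        rw [show g a x = _ from hgx]
        simp only [f, this]
      rw [this, sub_self, mul_zero]
  have hone : ∑ a, ∑ x, r a x * (f x - g a x) = r a₀ x₀ := by
    rw [Finset.sum_eq_single a₀, Finset.sum_eq_single x₀]
    · have h1 : f x₀ = 1 := by simp [f]
      have h2 : g a₀ x₀ = 0 := by
        rw [show g a₀ x₀ = _ from hgc c₀ x₀ (cycleGraph_adj_iff.1 hadj), if_neg hbridge]
      rw [h1, h2, sub_zero, mul_one]
    · exact fun x _ hx => hterm a₀ x fun h => hx (Prod.ext_iff.1 h).2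
    · simp
    · exact fun a _ ha => Finset.sum_eq_zero fun x _ => hterm a x fun h => ha (Prod.ext_iff.1 h).1
    · simp
  exact hne (hone.symm.trans hzero)

/-- The product, in any order, of the permutations of a tree-like multi-set is transitive. -/
theorem exists_prod_pow_eq [Fintype I] (h : IsTreeLike π) {l : List I} (hl : l.Nodup)
    (hl' : ∀ i ∉ l, π i = 1) (x y : X) : ∃ k : ℕ, ((l.map π).prod ^ k) x = y := by
  classical
  let f : X → ℚ := fun z => if (l.map π).prod.SameCycle x z then 1 else 0
  have hf : ∀ i z, f (π i z) = f z := by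
    intro i z
    by_cases hi : i ∈ l
    · exact h.independentOrbits.invariant_of_prod hl
        (fun z => by simp [f, Equiv.Perm.sameCycle_apply_right]) i hi z
    · simp [hl' i hi]
  have := h.eq_of_invariant hf x y
  have hxy : (l.map π).prod.SameCycle x y := by
    by_contra hxy
    simp [f, hxy, Equiv.Perm.SameCycle.refl] at this
  exact hxy.exists_nat_pow_eq

end IsTreeLike

/-! ### Self-replication -/

section Transitive

variable {α : Type*} [Fintype α]

theorem isCycleOn_of_transitive {σ : Equiv.Perm α} (h : ∀ x y, ∃ k : ℕ, (σ ^ k) x = y) :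
    σ.IsCycleOn (Finset.univ : Finset α) := by
  refine ⟨by simp, fun x _ y _ => ?_⟩
  obtain ⟨k, hk⟩ := h x y
  exact ⟨k, by simpa using hk⟩

theorem pow_card_eq_one_of_transitive {σ : Equiv.Perm α} (h : ∀ x y, ∃ k : ℕ, (σ ^ k) x = y) :
    σ ^ Fintype.card α = 1 :=
  Equiv.ext fun x => (isCycleOn_of_transitive h).pow_card_apply (Finset.mem_univ x)

theorem sum_range_pow_of_transitive {σ : Equiv.Perm α} (h : ∀ x y, ∃ k : ℕ, (σ ^ k) x = y) (x : α)
    {M : Type*} [AddCommMonoid M] (F : α → M) :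
    ∑ t ∈ Finset.range (Fintype.card α), F ((σ ^ t) x) = ∑ y, F y := by
  refine Finset.sum_nbij (fun t => (σ ^ t) x) (fun _ _ => Finset.mem_univ _) ?_ ?_ fun _ _ => rfl
  · intro s hs t ht hst
    have := ((isCycleOn_of_transitive h).pow_apply_eq_pow_apply (Finset.mem_univ x)).1 hst
    rw [Finset.card_univ] at this
    exact this.eq_of_lt_of_lt (by simpa using hs) (by simpa using ht)
  · intro y _
    obtain ⟨t, ht, rfl⟩ :=
      (isCycleOn_of_transitive h).exists_pow_eq (Finset.mem_univ x) (Finset.mem_univ y)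
    exact ⟨t, by simpa using ht, rfl⟩

end Transitive

namespace TreeAut

variable {X : Type*}

theorem conj_of_restrict_eq_one {u q : TreeAut X} {v w : List X} (hu : u.1 v = w)
    (hu1 : restrict u v = 1) (hq : q.1 v = v) :
    (u * q * u⁻¹).1 w = w ∧ restrict (u * q * u⁻¹) w = restrict q v := by
  have h1 : (u⁻¹).1 w = v := inv_apply_eq.2 hu.symm
  refine ⟨by rw [mul_apply, mul_apply, h1, hq, hu], ?_⟩
  rw [restrict_mul, restrict_mul, h1, hq, hu1, one_mul, ← hu, restrict_inv, hu1, inv_one, mul_one]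

end TreeAut

namespace InvertibleAutomaton

open TreeAut

variable {S X : Type*} (A : InvertibleAutomaton S X)

theorem run_cons (a : S) (x : X) (v : List X) : A.run a (x :: v) = A.run (A.next a x) v := rfl

theorem run_append (a : S) (v w : List X) : A.run a (v ++ w) = A.run (A.run a v) w :=
  List.foldl_append

theorem toAut_singleton (a : S) (x : X) : (A.toAut a).1 [x] = [A.perm a x] := rfl

theorem restrict_toAut_singleton (a : S) (x : X) :
    restrict (A.toAut a) [x] = A.toAut (A.next a x) :=
  ext_apply fun _ => restrict_apply_eq rfl

theorem restrict_toAut (a : S) (v : List X) : restrict (A.toAut a) v = A.toAut (A.run a v) := by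
  induction v generalizing a with
  | nil => exact restrict_nil _
  | cons x v ih => rw [restrict_cons, restrict_toAut_singleton, ih, run_cons]

variable {A}

theorem toAut_run_eq_one {a : S} (h : A.toAut a = 1) (v : List X) : A.toAut (A.run a v) = 1 := by
  rw [← restrict_toAut, h, restrict_one]

theorem toAut_next_eq_one {a : S} (h : A.toAut a = 1) (x : X) : A.toAut (A.next a x) = 1 :=
  toAut_run_eq_one h [x]

theorem perm_eq_one {a : S} (h : A.toAut a = 1) : A.perm a = 1 := by
  ext x
  have := A.toAut_singleton a x
  rw [h] at this
  simpa using this.symm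

theorem toAut_mem_group (a : S) : A.toAut a ∈ A.group := Subgroup.subset_closure ⟨a, rfl⟩

theorem restrict_mem_group {g : TreeAut X} (hg : g ∈ A.group) (v : List X) :
    restrict g v ∈ A.group := by
  induction hg using Subgroup.closure_induction generalizing v with
  | mem g hg =>
    obtain ⟨a, rfl⟩ := hg
    rw [restrict_toAut]
    exact toAut_mem_group _
  | one => rw [restrict_one]; exact one_mem _
  | mul g h _ _ ihg ihh => rw [restrict_mul]; exact mul_mem (ihg _) (ihh _)
  | inv g _ ih =>
    obtain ⟨w, rfl⟩ := g.1.surjective v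
    rw [restrict_inv]
    exact inv_mem (ih _)

theorem toAut_pow_singleton (a : S) (i : ℕ) (x : X) :
    (A.toAut a ^ i).1 [x] = [(A.perm a ^ i) x] := by
  induction i with
  | zero => simp
  | succ i ih => rw [pow_succ', pow_succ', TreeAut.mul_apply, ih, toAut_singleton, Equiv.Perm.mul_apply]

/-- If the restrictions of `a` at the letters of a cycle are trivial, except possibly at `y`, then
one can go round the cycle from the successor of `y` to any letter without picking up a
restriction. -/
theorem exists_pow_restrict_eq_one [Finite X] {a : S} {y : X}
    (hy : ∀ z, (A.perm a).SameCycle y z → z ≠ y → A.toAut (A.next a z) = 1) {z : X}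
    (hz : (A.perm a).SameCycle y z) :
    ∃ i : ℕ, (A.toAut a ^ i).1 [A.perm a y] = [z] ∧
      restrict (A.toAut a ^ i) [A.perm a y] = 1 := by
  classical
  have hex : ∃ i : ℕ, (A.perm a ^ i) (A.perm a y) = z :=
    (Equiv.Perm.sameCycle_apply_left.2 hz).exists_nat_pow_eq
  have hmin : ∀ j < Nat.find hex, (A.perm a ^ j) (A.perm a y) ≠ y := by
    intro j hj h
    refine Nat.find_min hex (m := Nat.find hex - (j + 1)) (by omega) ?_
    conv_rhs => rw [← Nat.find_spec hex]
    conv_rhs => rw [← Nat.sub_add_cancel (show j + 1 ≤ Nat.find hex by omega), pow_add,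
      Equiv.Perm.mul_apply, pow_succ', Equiv.Perm.mul_apply, h]
  have key : ∀ j ≤ Nat.find hex, restrict (A.toAut a ^ j) [A.perm a y] = 1 := by
    intro j
    induction j with
    | zero => simp
    | succ j ih =>
      intro hj
      rw [pow_succ', restrict_mul, ih (by omega), toAut_pow_singleton, restrict_toAut_singleton,
        mul_one]
      refine hy _ ?_ (hmin j (by omega))
      exact Equiv.Perm.sameCycle_pow_right.2
        (Equiv.Perm.sameCycle_apply_right.2 (Equiv.Perm.SameCycle.refl _ _))
  exact ⟨Nat.find hex, by rw [toAut_pow_singleton, Nat.find_spec hex], key _ le_rfl⟩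

variable [Fintype X] [DecidableEq X]

namespace IsPolynomialLike

variable (hA : A.IsPolynomialLike)

include hA

theorem exists_exceptional_letter (a : S) (x : X) : ∃ y, (A.perm a).SameCycle x y ∧
    ∀ z, (A.perm a).SameCycle y z → z ≠ y → A.toAut (A.next a z) = 1 := by
  by_cases h : ∃ y, (A.perm a).SameCycle x y ∧ A.toAut (A.next a y) ≠ 1
  · obtain ⟨y, hxy, hy⟩ := h
    refine ⟨y, hxy, fun z hz hne => ?_⟩
    by_contra hz1
    exact hne (hA.cycle_restrict a y z hz hy hz1).symm
  · push Not at h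
    exact ⟨x, Equiv.Perm.SameCycle.refl _ _, fun z hz _ => h z hz⟩

/-- Any letter can be moved to any other one by an element of the group with trivial restriction. -/
theorem exists_move_letter (x y : X) :
    ∃ u ∈ A.group, u.1 [x] = [y] ∧ restrict u [x] = 1 := by
  let R : X → X → Prop := fun x y => ∃ u ∈ A.group, u.1 [x] = [y] ∧ restrict u [x] = 1
  have hsymm : ∀ {x y}, R x y → R y x := by
    rintro x y ⟨u, hu, hxy, hu1⟩
    refine ⟨u⁻¹, inv_mem hu, inv_apply_eq.2 hxy.symm, ?_⟩
    rw [← hxy, restrict_inv, hu1, inv_one]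
  have htrans : ∀ {x y z}, R x y → R y z → R x z := by
    rintro x y z ⟨u, hu, hxy, hu1⟩ ⟨w, hw, hyz, hw1⟩
    refine ⟨w * u, mul_mem hw hu, by rw [TreeAut.mul_apply, hxy, hyz], ?_⟩
    rw [restrict_mul, hxy, hw1, hu1, one_mul]
  have hstep : ∀ a x, R x (A.perm a x) := by
    intro a x
    obtain ⟨y, hxy, hy⟩ := hA.exists_exceptional_letter a x
    have hR : ∀ z, (A.perm a).SameCycle y z → R (A.perm a y) z := fun z hz =>
      let ⟨i, hi⟩ := exists_pow_restrict_eq_one hy hz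
      ⟨_, pow_mem (toAut_mem_group a) i, hi⟩
    exact htrans (hsymm (hR x hxy.symm))
      (hR _ (Equiv.Perm.sameCycle_apply_right.2 hxy.symm))
  have := hA.treeLike.eq_of_invariant (f := fun z => R x z)
    (fun a z => propext ⟨fun h => htrans h (hsymm (hstep a z)), fun h => htrans h (hstep a z)⟩) x y
  exact this.mp ⟨1, one_mem _, rfl, restrict_one _⟩

/-- The group is self-replicating, at the letters. -/
theorem exists_fix_letter (x : X) {g : TreeAut X} (hg : g ∈ A.group) :
    ∃ p ∈ A.group, p.1 [x] = [x] ∧ restrict p [x] = g := by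
  induction hg using Subgroup.closure_induction with
  | mem g hg =>
    obtain ⟨b, rfl⟩ := hg
    by_cases hb : A.toAut b = 1
    · exact ⟨1, one_mem _, rfl, by rw [restrict_one, hb]⟩
    obtain ⟨⟨a, y⟩, hay : A.next a y = b, -⟩ := hA.unique_arrow ⟨b, hb⟩
    have hy : ∀ z, (A.perm a).SameCycle y z → z ≠ y → A.toAut (A.next a z) = 1 := by
      intro z hz hne
      by_contra hz1
      exact hne (hA.cycle_restrict a y z hz (hay ▸ hb) hz1).symm
    -- the first return of `a` to `y` has restriction `b` there
    obtain ⟨i, hi, hi1⟩ := exists_pow_restrict_eq_one hy (Equiv.Perm.SameCycle.refl _ y)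
    obtain ⟨u, hu, hyx, hu1⟩ := hA.exists_move_letter y x
    have hq : (A.toAut a ^ (i + 1)).1 [y] = [y] := by
      rw [pow_succ, TreeAut.mul_apply, toAut_singleton, hi]
    obtain ⟨h1, h2⟩ := conj_of_restrict_eq_one hyx hu1 hq
    refine ⟨_, mul_mem (mul_mem hu (pow_mem (toAut_mem_group a) (i + 1))) (inv_mem hu), h1, ?_⟩
    rw [h2, pow_succ, restrict_mul, toAut_singleton, hi1, one_mul, restrict_toAut_singleton, hay]
  | one => exact ⟨1, one_mem _, rfl, restrict_one _⟩
  | mul g h _ _ ihg ihh =>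
    obtain ⟨p, hp, hpx, hp1⟩ := ihg
    obtain ⟨q, hq, hqx, hq1⟩ := ihh
    exact ⟨p * q, mul_mem hp hq, by rw [TreeAut.mul_apply, hqx, hpx],
      by rw [restrict_mul, hqx, hp1, hq1]⟩
  | inv g _ ih =>
    obtain ⟨p, hp, hpx, hp1⟩ := ih
    refine ⟨p⁻¹, inv_mem hp, inv_apply_eq.2 hpx.symm, ?_⟩
    conv_lhs => rw [← hpx]
    rw [restrict_inv, hp1]

theorem exists_fix_word (v : List X) {g : TreeAut X} (hg : g ∈ A.group) :
    ∃ p ∈ A.group, p.1 v = v ∧ restrict p v = g := by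
  induction v with
  | nil => exact ⟨g, hg, apply_nil g, restrict_nil g⟩
  | cons x v ih =>
    obtain ⟨q, hq, hqv, hq1⟩ := ih
    obtain ⟨p, hp, hpx, hp1⟩ := hA.exists_fix_letter x hq
    exact ⟨p, hp, by rw [apply_cons, hpx, hp1, hqv]; rfl, by rw [restrict_cons, hp1, hq1]⟩

theorem exists_move_word {v w : List X} (hvw : v.length = w.length) :
    ∃ u ∈ A.group, u.1 v = w ∧ restrict u v = 1 := by
  induction v generalizing w with
  | nil =>
    obtain rfl : w = [] := List.length_eq_zero_iff.1 hvw.symm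
    exact ⟨1, one_mem _, rfl, restrict_one _⟩
  | cons x v ih =>
    rcases w with _ | ⟨y, w⟩
    · simp at hvw
    obtain ⟨q, hq, hqv, hq1⟩ := ih (w := w) (by simpa using hvw)
    obtain ⟨u, hu, hux, hu1⟩ := hA.exists_move_letter x y
    obtain ⟨p, hp, hpy, hp1⟩ := hA.exists_fix_letter y hq
    have h1 : u.1 (x :: v) = y :: v := by rw [apply_cons, hux, hu1]; rfl
    refine ⟨p * u, mul_mem hp hu, ?_, ?_⟩
    · rw [TreeAut.mul_apply, h1, apply_cons, hpy, hp1, hqv]; rfl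
    · rw [restrict_mul, h1, restrict_cons p, hp1, hq1, restrict_cons u, hu1, restrict_one, one_mul]

end IsPolynomialLike

end InvertibleAutomaton

/-! ### Products of all states -/

namespace InvertibleAutomaton

open TreeAut

variable {S X : Type*} (A : InvertibleAutomaton S X)

/-- The list contains each non-trivial state exactly once, and no trivial state. -/
def IsOrdering (l : List S) : Prop := l.Nodup ∧ ∀ a, a ∈ l ↔ A.toAut a ≠ 1

/-- The product of the automorphisms defined by a list of states. -/
def listAut (l : List S) : TreeAut X := (l.map A.toAut).prod

/-- The states that act after the states of a list have read the letter `x`, in the same order: the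
last state reads `x` itself. -/
def letterSections : List S → X → List S
  | [], _ => []
  | a :: l, x => A.next a ((l.map A.perm).prod x) :: letterSections l x

/-- The list of states describing the restriction at `x` of the `k`-th power of a product. -/
def powSections (l : List S) (x : X) : ℕ → List S
  | 0 => []
  | k + 1 => A.letterSections l (((l.map A.perm).prod ^ k) x) ++ powSections l x k

variable {A}

theorem listAut_cons (a : S) (l : List S) : A.listAut (a :: l) = A.toAut a * A.listAut l := by
  simp [listAut]

theorem listAut_append (l l' : List S) : A.listAut (l ++ l') = A.listAut l * A.listAut l' := by
  simp [listAut]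

theorem listAut_mem_group (l : List S) : A.listAut l ∈ A.group := by
  induction l with
  | nil => exact one_mem _
  | cons a l ih => rw [listAut_cons]; exact mul_mem (toAut_mem_group a) ih

theorem listAut_singleton (l : List S) (x : X) :
    (A.listAut l).1 [x] = [(l.map A.perm).prod x] := by
  induction l with
  | nil => rfl
  | cons a l ih => rw [listAut_cons, TreeAut.mul_apply, ih, toAut_singleton]; simp

theorem listAut_pow_singleton (l : List S) (k : ℕ) (x : X) :
    (A.listAut l ^ k).1 [x] = [((l.map A.perm).prod ^ k) x] := by
  induction k with
  | zero => rfl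
  | succ k ih => rw [pow_succ', TreeAut.mul_apply, ih, listAut_singleton, pow_succ',
      Equiv.Perm.mul_apply]

theorem restrict_listAut (l : List S) (x : X) :
    restrict (A.listAut l) [x] = A.listAut (A.letterSections l x) := by
  induction l with
  | nil => exact restrict_one _
  | cons a l ih =>
    rw [listAut_cons, restrict_mul, ih, listAut_singleton, restrict_toAut_singleton, letterSections,
      listAut_cons]

theorem restrict_listAut_pow (l : List S) (x : X) (k : ℕ) :
    restrict (A.listAut l ^ k) [x] = A.listAut (A.powSections l x k) := by
  induction k with
  | zero => exact restrict_one _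
  | succ k ih =>
    rw [pow_succ', restrict_mul, ih, listAut_pow_singleton, restrict_listAut, powSections,
      listAut_append]

open Classical in
theorem listAut_filter (l : List S) :
    A.listAut (l.filter fun a => A.toAut a ≠ 1) = A.listAut l := by
  induction l with
  | nil => rfl
  | cons a l ih =>
    by_cases ha : A.toAut a = 1
    · rw [List.filter_cons_of_neg (by simpa using ha), ih, listAut_cons, ha, one_mul]
    · rw [List.filter_cons_of_pos (by simpa using ha), listAut_cons, listAut_cons, ih]

theorem exists_isOrdering [Finite S] : ∃ l, A.IsOrdering l := by
  classical
  cases nonempty_fintype S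
  exact ⟨(Finset.univ.filter fun a => A.toAut a ≠ 1).toList, Finset.nodup_toList _, fun a => by simp⟩

theorem count_letterSections_sum [Fintype X] [DecidableEq S] (l : List S) (b : S) :
    ∑ x, (A.letterSections l x).count b =
      (l.map fun a => (Finset.univ.filter fun x => A.next a x = b).card).sum := by
  induction l with
  | nil => simp [letterSections]
  | cons a l ih =>
    simp only [letterSections, List.count_cons, Finset.sum_add_distrib, ih, List.map_cons,
      List.sum_cons]
    rw [add_comm, Finset.card_filter]
    congr 1
    simp only [beq_iff_eq]
    exact Equiv.sum_comp (l.map A.perm).prod fun x => if A.next a x = b then 1 else 0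

theorem count_powSections [DecidableEq S] (l : List S) (x : X) (k : ℕ) (b : S) :
    (A.powSections l x k).count b =
      ∑ t ∈ Finset.range k, (A.letterSections l (((l.map A.perm).prod ^ t) x)).count b := by
  induction k with
  | zero => simp [powSections]
  | succ k ih => rw [powSections, List.count_append, ih, Finset.sum_range_succ, add_comm]

variable [Fintype X] [DecidableEq X]

namespace IsPolynomialLike

variable (hA : A.IsPolynomialLike)

include hA

theorem exists_pow_letter [Finite S] {l : List S} (hl : A.IsOrdering l) (x y : X) :
    ∃ k : ℕ, ((l.map A.perm).prod ^ k) x = y := by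
  cases nonempty_fintype S
  refine hA.treeLike.exists_prod_pow_eq hl.1 (fun a ha => perm_eq_one ?_) x y
  by_contra h
  exact ha ((hl.2 a).2 h)

/-- If `o` is the product of the non-trivial states in some order, then `o ^ d`, with `d` the number
of letters, fixes the letters, and its restriction at a letter is again the product of the
non-trivial states in some order: as `o` is transitive on the letters, each pair of a state and a
letter is met once in the orbit, and each non-trivial state has only one arrow into it. -/
theorem exists_isOrdering_restrict [Finite S] {l : List S} (hl : A.IsOrdering l) (x : X) :
    ∃ l', A.IsOrdering l' ∧ (A.listAut l ^ Fintype.card X).1 [x] = [x] ∧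
      restrict (A.listAut l ^ Fintype.card X) [x] = A.listAut l' := by
  classical
  have htr := hA.exists_pow_letter hl
  refine ⟨(A.powSections l x (Fintype.card X)).filter fun a => A.toAut a ≠ 1, ?_, ?_, ?_⟩
  · have hcount : ∀ b, A.toAut b ≠ 1 → (A.powSections l x (Fintype.card X)).count b = 1 := by
      intro b hb
      rw [count_powSections,
        sum_range_pow_of_transitive htr x (fun y => (A.letterSections l y).count b),
        count_letterSections_sum, ← List.sum_toFinset _ hl.1]
      obtain ⟨⟨a, y⟩, hay : A.next a y = b, huniq⟩ := hA.unique_arrow ⟨b, hb⟩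
      have ha : a ∈ l := (hl.2 a).2 fun h => hb (hay ▸ toAut_next_eq_one h y)
      rw [Finset.sum_eq_single a, Finset.card_eq_one]
      · refine ⟨y, Finset.ext fun z => ?_⟩
        rw [Finset.mem_filter, Finset.mem_singleton]
        refine ⟨fun h => (Prod.ext_iff.1 (huniq (a, z) h.2)).2, ?_⟩
        rintro rfl
        exact ⟨Finset.mem_univ _, hay⟩
      · intro a' _ ha'
        rw [Finset.card_eq_zero, Finset.filter_eq_empty_iff]
        exact fun z _ h => ha' (Prod.ext_iff.1 (huniq (a', z) h)).1
      · exact fun h => (h (List.mem_toFinset.2 ha)).elim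
    refine ⟨List.nodup_iff_count_le_one.2 fun b => ?_, fun b => ?_⟩
    · by_cases hb : A.toAut b = 1
      · rw [List.count_eq_zero_of_not_mem (by simp [hb])]
        exact zero_le_one
      · rw [List.count_filter (by simpa using hb), hcount b hb]
    · rw [List.mem_filter]
      refine ⟨fun h => by simpa using h.2, fun hb => ⟨?_, by simpa using hb⟩⟩
      rw [← List.count_pos_iff, hcount b hb]
      exact zero_lt_one
  · rw [listAut_pow_singleton, pow_card_eq_one_of_transitive htr, Equiv.Perm.one_apply]
  · rw [restrict_listAut_pow, listAut_filter]

theorem exists_pow_word [Finite S] {n : ℕ} {l : List S} (hl : A.IsOrdering l) {u v : List X}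
    (hu : u.length = n) (hv : v.length = n) : ∃ k : ℕ, (A.listAut l ^ k).1 u = v := by
  induction n generalizing l u v with
  | zero =>
    rw [List.length_eq_zero_iff] at hu hv
    exact ⟨0, by rw [hu, hv]; rfl⟩
  | succ n ih =>
    rcases u with _ | ⟨x, u⟩
    · simp at hu
    rcases v with _ | ⟨y, v⟩
    · simp at hv
    obtain ⟨i, hi⟩ := hA.exists_pow_letter hl x y
    obtain ⟨l', hl', hfix, hres⟩ := hA.exists_isOrdering_restrict hl y
    obtain ⟨j, hj⟩ := ih hl' (u := (restrict (A.listAut l ^ i) [x]).1 u) (v := v)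
      (by rw [length_apply]; simpa using hu) (by simpa using hv)
    refine ⟨Fintype.card X * j + i, ?_⟩
    rw [pow_add, TreeAut.mul_apply, apply_cons, listAut_pow_singleton, hi, pow_mul,
      apply_append_restrict, pow_apply_of_fixed hfix, restrict_pow_of_fixed hfix, hres, hj]
    rfl

theorem pow_mem_levelStab [Finite S] {l : List S} (hl : A.IsOrdering l) (n : ℕ) :
    A.listAut l ^ (Fintype.card X ^ n) ∈ levelStab X n := by
  rw [levelStab, MonoidHom.mem_ker, map_pow, ← Word.card]
  refine pow_card_eq_one_of_transitive fun u v => ?_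
  obtain ⟨k, hk⟩ := hA.exists_pow_word hl u.2 v.2
  refine ⟨k, Subtype.ext ?_⟩
  rw [← map_pow]
  exact hk

/-- There is a normal subgroup that is transitive on the levels, contains the product of the
non-trivial states in some order, and consists of restrictions at any given vertex of its elements
that stabilise the level of the vertex.

The orderings of the states are finite in number, so some ordering is recovered, periodically, when
one passes from the product `o` of an ordering to the restriction of `o ^ d`; the normal closure of
the products in such a periodic orbit is as required. -/
theorem exists_normal_transitive [Finite S] [Nonempty X] :
    ∃ H : Subgroup A.group, H.Normal ∧
      (∀ u v : List X, u.length = v.length → ∃ s ∈ H, s.1.1 u = v) ∧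
      (∀ v : List X, ∀ s ∈ H, ∃ t ∈ H, t.1 ∈ levelStab X v.length ∧ restrict t.1 v = s.1) ∧
      ∃ l, A.IsOrdering l ∧ ∃ o ∈ H, o.1 = A.listAut l := by
  classical
  cases nonempty_fintype S
  let x₀ : X := Classical.arbitrary X
  let d := Fintype.card X
  have hstep : ∀ l : {l : List S // A.IsOrdering l}, ∃ l' : {l : List S // A.IsOrdering l},
      (A.listAut l.1 ^ d).1 [x₀] = [x₀] ∧ restrict (A.listAut l.1 ^ d) [x₀] = A.listAut l'.1 :=
    fun l => let ⟨l', h, h'⟩ := hA.exists_isOrdering_restrict l.2 x₀; ⟨⟨l', h⟩, h'⟩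
  choose T hTfix hTres using hstep
  have : Finite {l : List S // A.IsOrdering l} :=
    Finite.of_injective (β := {l : List S // l.Nodup}) (fun l => ⟨l.1, l.2.1⟩)
      fun l l' h => Subtype.ext (congrArg (fun l : {l : List S // l.Nodup} => l.1) h)
  obtain ⟨l₀, hl₀⟩ := exists_isOrdering (A := A)
  obtain ⟨l, p, hp, hlp⟩ : ∃ (l : {l : List S // A.IsOrdering l}) (p : ℕ), 0 < p ∧
      T^[p] l = l := by
    obtain ⟨m, n, hmn, h⟩ := Finite.exists_ne_map_eq_of_infinite fun n : ℕ => T^[n] ⟨l₀, hl₀⟩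
    wlog hlt : m < n generalizing m n
    · exact this n m hmn.symm h.symm (by omega)
    refine ⟨T^[m] ⟨l₀, hl₀⟩, n - m, by omega, ?_⟩
    rw [← Function.iterate_add_apply, Nat.sub_add_cancel hlt.le]
    exact h.symm
  have hpow : ∀ n (l : {l : List S // A.IsOrdering l}),
      restrict (A.listAut l.1 ^ d ^ n) (List.replicate n x₀) = A.listAut (T^[n] l).1 := by
    intro n
    induction n with
    | zero => intro l; simp
    | succ n ih =>
      intro l
      rw [List.replicate_succ, restrict_cons, pow_succ', pow_mul, restrict_pow_of_fixed (hTfix l),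
        hTres, ih, Function.iterate_succ_apply]
  let gen : Set A.group := {g | ∃ i, g.1 = A.listAut (T^[i] l).1}
  let H : Subgroup A.group := Subgroup.normalClosure gen
  have hmem : ∀ i, (⟨A.listAut (T^[i] l).1, listAut_mem_group _⟩ : A.group) ∈ H :=
    fun i => Subgroup.subset_normalClosure ⟨i, rfl⟩
  have hHn : H.Normal := Subgroup.normalClosure_normal
  let N : Subgroup A.group :=
    { carrier := {s | ∀ v : List X, ∃ t ∈ H, t.1 ∈ levelStab X v.length ∧ restrict t.1 v = s.1}
      one_mem' := fun v => ⟨1, one_mem _, one_mem _, restrict_one _⟩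
      mul_mem' := by
        intro s s' hs hs' v
        obtain ⟨t, ht, htn, hts⟩ := hs v
        obtain ⟨t', ht', htn', hts'⟩ := hs' v
        refine ⟨t * t', mul_mem ht ht', mul_mem htn htn', ?_⟩
        rw [Subgroup.coe_mul, restrict_mul, mem_levelStab.1 htn' v rfl, hts, hts', Subgroup.coe_mul]
      inv_mem' := by
        intro s hs v
        obtain ⟨t, ht, htn, hts⟩ := hs v
        refine ⟨t⁻¹, inv_mem ht, inv_mem htn, ?_⟩
        conv_lhs => rw [← mem_levelStab.1 htn v rfl]
        rw [Subgroup.coe_inv, restrict_inv, hts, Subgroup.coe_inv] }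
  have hN : N.Normal := by
    refine ⟨fun s hs h v => ?_⟩
    obtain ⟨t, ht, htn, hts⟩ := hs v
    obtain ⟨q, hq, hqv, hqh⟩ := hA.exists_fix_word v h.2
    have hqv' : (q⁻¹).1 v = v := inv_apply_eq.2 hqv.symm
    have hqh' : restrict q⁻¹ v = h.1⁻¹ := by
      conv_lhs => rw [← hqv]
      rw [restrict_inv, hqh]
    have hconj : q * t.1 * q⁻¹ ∈ levelStab X v.length :=
      (inferInstance : (levelStab X v.length).Normal).conj_mem _ htn q
    have hres : restrict (q * t.1 * q⁻¹) v = h.1 * s.1 * h.1⁻¹ := by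
      rw [restrict_mul, restrict_mul, hqv', mem_levelStab.1 htn v rfl, hqh', hqh, hts]
    exact ⟨_, hHn.conj_mem t ht ⟨q, hq⟩, hconj, hres⟩
  have hgen : gen ⊆ N := by
    rintro s ⟨i, hi⟩ v
    set n := v.length with hn
    let j := i + (p - 1) * n
    have hj : T^[n] (T^[j] l) = T^[i] l := by
      rw [← Function.iterate_add_apply, show n + j = i + p * n by
        obtain ⟨q, rfl⟩ : ∃ q, p = q + 1 := ⟨p - 1, by omega⟩
        simp only [j, Nat.add_sub_cancel]
        ring, Function.iterate_add_apply, Function.iterate_mul,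
        Function.iterate_fixed hlp]
    obtain ⟨u, hu, huv, hu1⟩ :=
      hA.exists_move_word (v := List.replicate n x₀) (w := v) (by simp [hn])
    have hstab := hA.pow_mem_levelStab (T^[j] l).2 n
    have hconj : u * A.listAut (T^[j] l).1 ^ d ^ n * u⁻¹ ∈ levelStab X n :=
      (inferInstance : (levelStab X n).Normal).conj_mem _ hstab u
    have hres := (conj_of_restrict_eq_one huv hu1 (mem_levelStab.1 hstab _ (by simp))).2
    rw [hpow, hj, ← hi] at hres
    have hH := hHn.conj_mem _ (pow_mem (hmem j) (d ^ n)) ⟨u, hu⟩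
    exact ⟨_, hH, hconj, hres⟩
  refine ⟨H, hHn, fun u v huv => ?_, fun v s hs => ?_, l.1, l.2, _, hmem 0, rfl⟩
  · obtain ⟨k, hk⟩ := hA.exists_pow_word l.2 huv rfl
    exact ⟨_, pow_mem (hmem 0) k, hk⟩
  · exact Subgroup.normalClosure_le_normal hgen hs v

end IsPolynomialLike

end InvertibleAutomaton

/-! ### Fixed vertices of the states -/

namespace TreeAut

variable {X : Type*}

theorem ofFn_eq_append (e : ℕ → X) {m n : ℕ} (h : m ≤ n) :
    (List.ofFn fun i : Fin n => e i) =
      (List.ofFn fun i : Fin m => e i) ++ List.ofFn fun i : Fin (n - m) => e (m + i) := by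
  obtain ⟨k, rfl⟩ := Nat.exists_eq_add_of_le h
  rw [List.ofFn_add]
  congr 1
  refine List.ext_getElem (by simp) fun i _ _ => ?_
  simp

/-- By compactness, an automorphism that fixes a vertex of every level fixes an end. -/
theorem fixedEnds_nonempty [Finite X] {g : TreeAut X} (h : ∀ n, ∃ v : List X, v.length = n ∧ g.1 v = v) :
    (fixedEnds g).Nonempty := by
  let _ : TopologicalSpace X := ⊥
  have : DiscreteTopology X := ⟨rfl⟩
  let C : ℕ → Set (ℕ → X) := fun n =>
    {e | g.1 (List.ofFn fun i : Fin n => e i) = List.ofFn fun i : Fin n => e i}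
  have hclosed : ∀ n, IsClosed (C n) := fun n => by
    have hc : Continuous fun (e : ℕ → X) (i : Fin n) => e i := by fun_prop
    exact (isClosed_discrete {w : Fin n → X | g.1 (List.ofFn w) = List.ofFn w}).preimage hc
  have hanti : ∀ m n, m ≤ n → C n ⊆ C m := by
    intro m n hmn e he
    have he' : g.1 (List.ofFn fun i : Fin n => e i) = List.ofFn fun i : Fin n => e i := he
    rw [ofFn_eq_append e hmn] at he'
    exact (fixed_of_append he').1
  have hne : ∀ n, (C n).Nonempty := by
    intro n
    obtain ⟨x, -⟩ : ∃ x : X, True := by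
      obtain ⟨v, hv, -⟩ := h 1
      exact ⟨v.head (by rintro rfl; simp at hv), trivial⟩
    obtain ⟨v, hv, hgv⟩ := h n
    refine ⟨fun i => v.getD i x, ?_⟩
    have : (List.ofFn fun i : Fin n => v.getD i x) = v := by
      subst hv
      refine List.ext_getElem (by simp) fun i _ _ => ?_
      simp
    change g.1 _ = _
    rw [this, hgv]
  obtain ⟨e, he⟩ := IsCompact.nonempty_iInter_of_directed_nonempty_isCompact_isClosed C
    (fun m n => ⟨max m n, hanti _ _ (le_max_left _ _), hanti _ _ (le_max_right _ _)⟩) hne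
    (fun n => (hclosed n).isCompact) hclosed
  exact ⟨e, fun n => Set.mem_iInter.1 he n⟩

end TreeAut

namespace InvertibleAutomaton

open TreeAut

variable {S X : Type*} {A : InvertibleAutomaton S X}

theorem levelAction_consEquiv (a : S) (n : ℕ) (x : X) (w : Word X n) :
    levelAction X (n + 1) (A.toAut a) (Word.consEquiv X n (x, w)) =
      Word.consEquiv X n (A.perm a x, levelAction X n (A.toAut (A.next a x)) w) := rfl

theorem reflTransGen_of_run {a b : A.NontrivialState} {u : List X} (h : A.run a.1 u = b.1) :
    Relation.ReflTransGen A.ReducedArrow a b := by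
  induction u generalizing a with
  | nil => rw [Subtype.ext (show a.1 = b.1 from h)]
  | cons x u ih =>
    have hne : A.toAut (A.next a.1 x) ≠ 1 := fun h1 => b.2 (h ▸ toAut_run_eq_one h1 u)
    exact Relation.ReflTransGen.head (b := ⟨A.next a.1 x, hne⟩) ⟨x, rfl⟩ (ih h)

theorem inReducedCycle_of_run {a : A.NontrivialState} {u : List X} (hu : u ≠ [])
    (h : A.run a.1 u = a.1) : A.InReducedCycle a := by
  rcases u with _ | ⟨x, u⟩
  · exact (hu rfl).elim
  · have hne : A.toAut (A.next a.1 x) ≠ 1 := fun h1 => a.2 (h ▸ toAut_run_eq_one h1 u)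
    exact Relation.TransGen.head' (b := ⟨A.next a.1 x, hne⟩) ⟨x, rfl⟩ (reflTransGen_of_run h)

variable [Fintype X] [DecidableEq X]

namespace IsPolynomialLike

variable (hA : A.IsPolynomialLike)

include hA

open Classical in
/-- Independence of the balanced functions on the level `n + 1` follows from that on the level `n`.
If a cycle of `a` on `X` has the restriction `b` at one letter and trivial restrictions at the
others, then summing over the letters of the cycle turns functions balanced for `a` into functions
balanced for `b`. -/
theorem independentOrbits_level [Fintype S] (n : ℕ) :
    IndependentOrbits fun a => levelAction X n (A.toAut a) := by
  induction n with
  | zero =>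
    intro r hr _ a u
    have := hr a (fun _ => 1) fun _ => rfl
    have huniq : ∀ v : Word X 0, v = u := fun v =>
      Subtype.ext ((List.length_eq_zero_iff.1 v.2).trans (List.length_eq_zero_iff.1 u.2).symm)
    rwa [Finset.sum_eq_single u (fun v _ hv => (hv (huniq v)).elim) (by simp), mul_one] at this
  | succ n ih =>
    intro r hr hsum
    let ρ : S → X → Word X n → ℚ := fun a x w => r a (Word.consEquiv X n (x, w))
    have hbal : ∀ a (f : X → Word X n → ℚ),
        (∀ x w, f (A.perm a x) (levelAction X n (A.toAut (A.next a x)) w) = f x w) →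
          ∑ x, ∑ w, ρ a x w * f x w = 0 := by
      intro a f hf
      have := hr a (fun u => f ((Word.consEquiv X n).symm u).1 ((Word.consEquiv X n).symm u).2) ?_
      · rw [← Equiv.sum_comp (Word.consEquiv X n), Fintype.sum_prod_type] at this
        simpa using this
      · intro u
        obtain ⟨⟨x, w⟩, rfl⟩ := (Word.consEquiv X n).surjective u
        simp only [levelAction_consEquiv, Equiv.symm_apply_apply, hf]
    have hfree : ∀ a (w : Word X n) (h : X → ℚ), (∀ x, h (A.perm a x) = h x) →
        (∀ x, h x ≠ 0 → A.toAut (A.next a x) = 1) → ∑ x, ρ a x w * h x = 0 := by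
      intro a w h hinv hh
      have := hbal a (fun x w' => if w' = w then h x else 0) ?_
      · simpa using this
      · intro x w'
        by_cases hx : h x = 0
        · simp [hinv, hx]
        · simp [hinv, hh x hx]
    let σ : S → X → Word X n → ℚ := fun a y w =>
      ∑ x, ρ a x w * if (A.perm a).SameCycle x y then 1 else 0
    have hσsame : ∀ {a x y}, (A.perm a).SameCycle x y → σ a x = σ a y := by
      intro a x y hxy
      funext w
      refine Finset.sum_congr rfl fun z _ => ?_
      simp only [show (A.perm a).SameCycle z x ↔ (A.perm a).SameCycle z y from
        ⟨fun h => h.trans hxy, fun h => h.trans hxy.symm⟩]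
    let s : S → Word X n → ℚ := fun b w =>
      ∑ a, ∑ y, if A.next a y = b ∧ A.toAut b ≠ 1 then σ a y w else 0
    have hs_arrow : ∀ a y, A.toAut (A.next a y) ≠ 1 → s (A.next a y) = σ a y := by
      intro a y hay
      funext w
      have huniq : ∀ a' y', A.next a' y' = A.next a y → a' = a ∧ y' = y := fun a' y' h =>
        Prod.ext_iff.1 ((hA.unique_arrow ⟨_, hay⟩).unique (y₁ := (a', y')) (y₂ := (a, y)) h rfl)
      simp only [s]
      rw [Finset.sum_eq_single a, Finset.sum_eq_single y]
      · simp [hay]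
      · exact fun y' _ hy' => if_neg fun h => hy' (huniq _ _ h.1).2
      · simp
      · exact fun a' _ ha' => Finset.sum_eq_zero fun y' _ => if_neg fun h => ha' (huniq _ _ h.1).1
      · simp
    have hs_bal : ∀ b, OrbitBalanced (levelAction X n (A.toAut b)) (s b) := by
      intro b
      by_cases hb : A.toAut b = 1
      · have : s b = fun _ => 0 := by
          funext w
          simp [s, hb]
        rw [this]
        exact orbitBalanced_zero _
      · obtain ⟨⟨a, y⟩, hay : A.next a y = b, -⟩ := hA.unique_arrow ⟨b, hb⟩
        subst hay
        rw [hs_arrow a y hb]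
        intro f hf
        have := hbal a (fun x w => (if (A.perm a).SameCycle x y then 1 else 0) * f w) ?_
        · rw [Finset.sum_comm] at this
          simp only [← mul_assoc, ← Finset.sum_mul] at this
          exact this
        · intro x w
          simp only [Equiv.Perm.sameCycle_apply_left]
          by_cases hxy : (A.perm a).SameCycle x y
          · congr 1
            by_cases hx : x = y
            · rw [hx, hf]
            · have : A.toAut (A.next a x) = 1 := by
                by_contra h1
                exact hx (hA.cycle_restrict a x y hxy h1 hb)
              rw [this, map_one, Equiv.Perm.one_apply]
          · simp [hxy]
    have hs_sum : ∀ w, ∑ b, s b w = 0 := by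
      intro w
      have h1 : ∑ b, s b w = ∑ a, ∑ y, if A.toAut (A.next a y) ≠ 1 then σ a y w else 0 := by
        simp only [s]
        rw [Finset.sum_comm]
        refine Finset.sum_congr rfl fun a _ => ?_
        rw [Finset.sum_comm]
        refine Finset.sum_congr rfl fun y _ => ?_
        rw [Finset.sum_eq_single (A.next a y)]
        · simp
        · exact fun b _ hb => if_neg fun h => hb h.1.symm
        · simp
      have h2 : ∀ a, (∑ y, if A.toAut (A.next a y) ≠ 1 then σ a y w else 0) = ∑ x, ρ a x w := by
        intro a
        -- each cycle contains at most one letter `y` with non-trivial restriction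
        let κ : X → ℚ := fun x =>
          ∑ y, if A.toAut (A.next a y) ≠ 1 ∧ (A.perm a).SameCycle x y then 1 else 0
        have hκ : ∀ x y, (A.perm a).SameCycle x y → A.toAut (A.next a y) ≠ 1 → κ x = 1 := by
          intro x y hxy hy
          simp only [κ]
          rw [Finset.sum_eq_single y]
          · rw [if_pos ⟨hy, hxy⟩]
          · exact fun z _ hz => if_neg fun h =>
              hz (hA.cycle_restrict a z y (h.2.symm.trans hxy) h.1 hy)
          · simp
        have h3 := hfree a w (fun x => 1 - κ x) (fun x => by simp [κ]) fun x hx => by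
          by_contra h
          exact hx (by rw [hκ x x (Equiv.Perm.SameCycle.refl _ _) h, sub_self])
        have h4 : ∑ x, ρ a x w * κ x = ∑ y, if A.toAut (A.next a y) ≠ 1 then σ a y w else 0 := by
          simp only [κ, σ, Finset.mul_sum]
          rw [Finset.sum_comm]
          refine Finset.sum_congr rfl fun y _ => ?_
          by_cases hy : A.toAut (A.next a y) = 1 <;> simp [hy]
        simp only [mul_sub, mul_one, Finset.sum_sub_distrib] at h3
        linarith
      rw [h1, Finset.sum_congr rfl fun a _ => h2 a, Finset.sum_comm]
      exact Finset.sum_eq_zero fun x _ => hsum _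
    have hs := ih s hs_bal hs_sum
    have hρ : ∀ w a x, ρ a x w = 0 := by
      intro w
      refine hA.treeLike.independentOrbits (fun a x => ρ a x w) (fun a => ?_) fun x => hsum _
      refine orbitBalanced_of_sum_sameCycle fun x => ?_
      have hσ0 : σ a x w = 0 := by
        by_cases h : ∃ y, (A.perm a).SameCycle x y ∧ A.toAut (A.next a y) ≠ 1
        · obtain ⟨y, hxy, hy⟩ := h
          rw [hσsame hxy, ← hs_arrow a y hy, hs]
        · push Not at h
          refine hfree a w _ (fun z => by simp) fun z hz => ?_
          by_cases hzx : (A.perm a).SameCycle z x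
          · exact h z hzx.symm
          · simp [hzx] at hz
      rw [← hσ0, Finset.sum_filter]
      exact Finset.sum_congr rfl fun y _ => by simp
    intro a u
    obtain ⟨⟨x, w⟩, rfl⟩ := (Word.consEquiv X n).surjective u
    exact hρ w a x

/-- Paths of the same length to a non-trivial state of the Moore diagram are equal. -/
theorem eq_of_run_eq {a a' : S} {u u' : List X} (hlen : u.length = u'.length)
    (h : A.run a u = A.run a' u') (hne : A.toAut (A.run a u) ≠ 1) : a = a' ∧ u = u' := by
  induction u using List.reverseRecOn generalizing u' with
  | nil =>
    obtain rfl : u' = [] := List.length_eq_zero_iff.1 hlen.symm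
    exact ⟨h, rfl⟩
  | append_singleton u x ih =>
    rcases List.eq_nil_or_concat u' with rfl | ⟨u', x', rfl⟩
    · simp at hlen
    rw [List.concat_eq_append] at *
    rw [run_append] at hne
    rw [run_append, run_append] at h
    have := (hA.unique_arrow ⟨_, hne⟩).unique (y₁ := (A.run a u, x)) (y₂ := (A.run a' u', x')) rfl
      h.symm
    rw [Prod.ext_iff] at this
    obtain ⟨rfl, rfl⟩ := ih (by simpa using hlen) this.1 fun h1 => hne (toAut_run_eq_one h1 [x])
    exact ⟨rfl, by rw [show x = x' from this.2]⟩

/-- Along an end with non-trivial restrictions a state recurs arbitrarily late: two of these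
restrictions coincide, and the paths to them can be traced back simultaneously until the shorter one
reaches its start. -/
theorem exists_return [Finite S] {c : S} {e : ℕ → X}
    (he : ∀ n, A.toAut (A.run c (List.ofFn fun i : Fin n => e i)) ≠ 1) (N : ℕ) :
    ∃ m > N, A.run c (List.ofFn fun i : Fin m => e i) = c := by
  obtain ⟨i, j, hij, h⟩ := Finite.exists_ne_map_eq_of_infinite
    fun i : ℕ => A.run c (List.ofFn fun k : Fin (i * (N + 1)) => e k)
  wlog hlt : i < j generalizing i j
  · exact this j i hij.symm h.symm (by omega)
  obtain ⟨k, rfl⟩ := Nat.exists_eq_add_of_lt hlt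
  refine ⟨(k + 1) * (N + 1), by nlinarith, ?_⟩
  have hle : (k + 1) * (N + 1) ≤ (i + k + 1) * (N + 1) := Nat.mul_le_mul_right _ (by omega)
  have hne := he (i * (N + 1))
  rw [ofFn_eq_append e hle, run_append] at h
  refine (hA.eq_of_run_eq ?_ h hne).1.symm
  simp only [List.length_ofFn]
  rw [← Nat.sub_mul]
  congr 1
  omega

/-- There is at most one end along which all restrictions of a given state are non-trivial: both ends
would be periodic, described by closed paths based at the state, and such paths commute. -/
theorem end_unique [Finite S] {c : S} {e e' : ℕ → X}
    (he : ∀ n, A.toAut (A.run c (List.ofFn fun i : Fin n => e i)) ≠ 1)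
    (he' : ∀ n, A.toAut (A.run c (List.ofFn fun i : Fin n => e' i)) ≠ 1) : e = e' := by
  funext n
  obtain ⟨m, hm, hmc⟩ := hA.exists_return he n
  obtain ⟨m', hm', hmc'⟩ := hA.exists_return he' n
  have hcomm := (hA.eq_of_run_eq (a := c) (a' := c)
    (u := (List.ofFn fun i : Fin m => e i) ++ List.ofFn fun i : Fin m' => e' i)
    (u' := (List.ofFn fun i : Fin m' => e' i) ++ List.ofFn fun i : Fin m => e i)
    (by simp [add_comm]) (by rw [run_append, run_append, hmc, hmc', hmc])
    (by rw [run_append, hmc, hmc']; simpa [run] using he 0)).2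
  have h1 := congrArg (fun l : List X => l[n]?) hcomm
  simpa [List.getElem?_append, hm, hm'] using h1

/-- A state that has a non-trivial restriction at each vertex it fixes has no fixed vertex from some
level on. -/
theorem exists_level_forall_ne [Finite S]
    (hends : ∀ a : A.NontrivialState, A.InReducedCycle a →
      TreeAut.fixedEnds (A.toAut a.1) = ∅ ∨ (TreeAut.fixedEnds (A.toAut a.1)).Infinite)
    {c : S} (hc : ∀ w, (A.toAut c).1 w = w → A.toAut (A.run c w) ≠ 1) :
    ∃ n, ∀ v : List X, n ≤ v.length → (A.toAut c).1 v ≠ v := by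
  by_contra hcon
  push Not at hcon
  obtain ⟨e, he⟩ := fixedEnds_nonempty (g := A.toAut c) fun n => by
    obtain ⟨v, hn, hv⟩ := hcon n
    rw [← List.take_append_drop n v] at hv
    exact ⟨v.take n, by simpa using hn, (fixed_of_append hv).1⟩
  have hne : ∀ e ∈ fixedEnds (A.toAut c), ∀ n,
      A.toAut (A.run c (List.ofFn fun i : Fin n => e i)) ≠ 1 := fun e he n => hc _ (he n)
  have hc1 : A.toAut c ≠ 1 := by simpa [run] using hne e he 0
  obtain ⟨m, hm, hmc⟩ := hA.exists_return (hne e he) 0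
  have hcyc : A.InReducedCycle ⟨c, hc1⟩ :=
    inReducedCycle_of_run (by simpa using hm.ne') hmc
  rcases hends ⟨c, hc1⟩ hcyc with h | h
  · exact (h ▸ he : e ∈ (∅ : Set (ℕ → X)))
  · refine h (Set.Subsingleton.finite ?_)
    exact fun e₁ h₁ e₂ h₂ => hA.end_unique (hne e₁ h₁) (hne e₂ h₂)

/-- A subgroup that contains the elements fixing some vertex with trivial restriction there contains
all states but at most one; if it also contains a product of the non-trivial states in some order,
then it is the whole group. -/
theorem eq_top_of_forall_restrict_eq_one [Finite S] [Nonempty X]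
    (hends : ∀ a : A.NontrivialState, A.InReducedCycle a →
      TreeAut.fixedEnds (A.toAut a.1) = ∅ ∨ (TreeAut.fixedEnds (A.toAut a.1)).Infinite)
    {I : Subgroup A.group}
    (hI : ∀ (g : A.group) (w : List X), g.1.1 w = w → restrict g.1 w = 1 → g ∈ I)
    {l : List S} (hl : A.IsOrdering l) {o : A.group} (hoI : o ∈ I) (hol : o.1 = A.listAut l) :
    I = ⊤ := by
  classical
  cases nonempty_fintype S
  let J : Subgroup (TreeAut X) := I.map A.group.subtype
  have hlevel : ∀ c, A.toAut c ∉ J → ∃ n, ∀ v : List X, n ≤ v.length → (A.toAut c).1 v ≠ v := by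
    intro c hc
    refine hA.exists_level_forall_ne hends fun w hw h1 => hc ?_
    exact ⟨⟨A.toAut c, toAut_mem_group c⟩, hI _ w hw (by rw [restrict_toAut, h1]), rfl⟩
  have huniq : ∀ c c', A.toAut c ∉ J → A.toAut c' ∉ J → c = c' := by
    intro c c' hc hc'
    obtain ⟨n, hn⟩ := hlevel c hc
    obtain ⟨n', hn'⟩ := hlevel c' hc'
    have : Nonempty (Word X (max n n')) :=
      ⟨⟨List.replicate _ (Classical.arbitrary X), List.length_replicate⟩⟩
    refine (hA.independentOrbits_level (max n n')).eq_of_forall_ne (fun v h => ?_) fun v h => ?_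
    · exact hn v.1 (by rw [v.2]; exact le_max_left _ _) (congrArg Subtype.val h)
    · exact hn' v.1 (by rw [v.2]; exact le_max_right _ _) (congrArg Subtype.val h)
  have hlist : ∀ l' : List S, (∀ a ∈ l', A.toAut a ∈ J) → A.listAut l' ∈ J := by
    intro l' h
    refine list_prod_mem fun g hg => ?_
    obtain ⟨a, ha, rfl⟩ := List.mem_map.1 hg
    exact h a ha
  have hall : ∀ c, A.toAut c ∈ J := by
    intro c
    by_contra hc
    have hc1 : A.toAut c ≠ 1 := fun h => hc (h ▸ one_mem J)
    obtain ⟨l₁, l₂, rfl⟩ := List.append_of_mem ((hl.2 c).2 hc1)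
    have hnd := hl.1
    rw [List.nodup_append, List.nodup_cons] at hnd
    have h1 : A.listAut l₁ ∈ J := hlist _ fun a ha => by
      by_contra h
      exact hnd.2.2 a ha c (by simp) (huniq a c h hc)
    have h2 : A.listAut l₂ ∈ J := hlist _ fun a ha => by
      by_contra h
      exact hnd.2.1.1 (huniq a c h hc ▸ ha)
    have ho : A.listAut (l₁ ++ c :: l₂) ∈ J := ⟨o, hoI, hol⟩
    rw [listAut_append, listAut_cons] at ho
    exact hc ((J.mul_mem_cancel_right h2).1 ((J.mul_mem_cancel_left h1).1 ho))
  have hle : A.group ≤ J := (Subgroup.closure_le J).2 (by rintro _ ⟨a, rfl⟩; exact hall a)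
  rw [eq_top_iff]
  rintro g -
  obtain ⟨g', hg', h⟩ := hle g.2
  rwa [← Subtype.ext (show g'.1 = g.1 from h)]

end IsPolynomialLike

end InvertibleAutomaton

/-! ### Mean values of locally constant functions -/

open Classical in
/-- The indicator of a proposition, as a real number. -/
noncomputable def ind (p : Prop) : ℝ := if p then 1 else 0

theorem ind_of {p : Prop} (h : p) : ind p = 1 := if_pos h

theorem ind_of_not {p : Prop} (h : ¬p) : ind p = 0 := if_neg h

theorem ind_nonneg (p : Prop) : 0 ≤ ind p := by
  unfold ind
  split_ifs <;> norm_num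

theorem ind_mono {p q : Prop} (h : p → q) : ind p ≤ ind q := by
  by_cases hp : p
  · rw [ind_of hp, ind_of (h hp)]
  · rw [ind_of_not hp]
    exact ind_nonneg q

theorem ind_and (p q : Prop) : ind (p ∧ q) = ind p * ind q := by
  by_cases hp : p <;> by_cases hq : q <;> simp [ind, hp, hq]

theorem ind_le_sum {ι : Type*} (s : Finset ι) {p : Prop} {q : ι → Prop}
    (h : p → ∃ i ∈ s, q i) : ind p ≤ ∑ i ∈ s, ind (q i) := by
  by_cases hp : p
  · obtain ⟨i, hi, hqi⟩ := h hp
    rw [ind_of hp, ← ind_of hqi]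
    exact Finset.single_le_sum (f := fun i => ind (q i)) (fun j _ => ind_nonneg _) hi
  · rw [ind_of_not hp]
    exact Finset.sum_nonneg fun j _ => ind_nonneg _

/-- A descending sequence of normal subgroups of finite index. -/
structure NormalTower (G : Type*) [Group G] where
  /-- The subgroups of the sequence. -/
  K : ℕ → Subgroup G
  anti : Antitone K
  normal : ∀ n, (K n).Normal
  finiteIndex : ∀ n, (K n).FiniteIndex

namespace NormalTower

variable {G : Type*} [Group G] (T : NormalTower G)

attribute [instance] NormalTower.normal NormalTower.finiteIndex

noncomputable instance (n : ℕ) : Fintype (G ⧸ T.K n) := Fintype.ofFinite _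

/-- A function on the group is locally constant if it factors through one of the quotients. -/
def LocConst {β : Type*} (f : G → β) : Prop := ∃ n, ∀ g, ∀ k ∈ T.K n, f (g * k) = f g

/-- The average of a function over representatives of the `n`-th quotient. -/
noncomputable def avg (n : ℕ) (f : G → ℝ) : ℝ :=
  (∑ q : G ⧸ T.K n, f q.out) / Nat.card (G ⧸ T.K n)

/-- The mean value of a locally constant function: its average over a sufficiently fine quotient, so
the integral with respect to the Haar measure of the completion. It is a meaningless limit for other
functions. -/
noncomputable def mean (f : G → ℝ) : ℝ := Filter.limUnder Filter.atTop fun n => T.avg n f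

variable {T}

section LocConst

variable {β γ δ : Type*}

theorem locConst_const (b : β) : T.LocConst fun _ => b := ⟨0, fun _ _ _ => rfl⟩

theorem LocConst.comp {f : G → β} (hf : T.LocConst f) (F : β → γ) :
    T.LocConst fun g => F (f g) := by
  obtain ⟨n, hn⟩ := hf
  exact ⟨n, fun g k hk => congrArg F (hn g k hk)⟩

theorem LocConst.comp₂ {f : G → β} {f' : G → γ} (hf : T.LocConst f) (hf' : T.LocConst f')
    (F : β → γ → δ) : T.LocConst fun g => F (f g) (f' g) := by
  obtain ⟨n, hn⟩ := hf
  obtain ⟨n', hn'⟩ := hf'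
  exact ⟨max n n', fun g k hk => congrArg₂ F (hn g k (T.anti (le_max_left _ _) hk))
    (hn' g k (T.anti (le_max_right _ _) hk))⟩

theorem LocConst.add {f f' : G → ℝ} (hf : T.LocConst f) (hf' : T.LocConst f') :
    T.LocConst fun g => f g + f' g := hf.comp₂ hf' _

theorem LocConst.sub {f f' : G → ℝ} (hf : T.LocConst f) (hf' : T.LocConst f') :
    T.LocConst fun g => f g - f' g := hf.comp₂ hf' _

theorem LocConst.mul {f f' : G → ℝ} (hf : T.LocConst f) (hf' : T.LocConst f') :
    T.LocConst fun g => f g * f' g := hf.comp₂ hf' _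

theorem LocConst.and {p q : G → Prop} (hp : T.LocConst p) (hq : T.LocConst q) :
    T.LocConst fun g => p g ∧ q g := hp.comp₂ hq _

theorem LocConst.not {p : G → Prop} (hp : T.LocConst p) : T.LocConst fun g => ¬p g := hp.comp _

theorem LocConst.sum {ι : Type*} (s : Finset ι) {f : ι → G → ℝ} (hf : ∀ i ∈ s, T.LocConst (f i)) :
    T.LocConst fun g => ∑ i ∈ s, f i g := by
  classical
  induction s using Finset.induction_on with
  | empty => simpa using locConst_const _
  | insert i s hi ih =>
    simp only [Finset.sum_insert hi]
    exact (hf i (Finset.mem_insert_self i s)).add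
      (ih fun j hj => hf j (Finset.mem_insert_of_mem hj))

theorem LocConst.mul_right {f : G → β} (hf : T.LocConst f) (h : G) :
    T.LocConst fun g => f (g * h) := by
  obtain ⟨n, hn⟩ := hf
  refine ⟨n, fun g k hk => ?_⟩
  have hk' := (T.normal n).conj_mem k hk h⁻¹
  rw [inv_inv] at hk'
  have := hn (g * h) _ hk'
  rwa [show g * h * (h⁻¹ * k * h) = g * k * h by group] at this

theorem LocConst.mul_left {f : G → β} (hf : T.LocConst f) (h : G) :
    T.LocConst fun g => f (h * g) := by
  obtain ⟨n, hn⟩ := hf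
  exact ⟨n, fun g k hk => (congrArg f (mul_assoc h g k).symm).trans (hn _ k hk)⟩

end LocConst

theorem out_apply {β : Type*} {n : ℕ} {f : G → β} (hf : ∀ g, ∀ k ∈ T.K n, f (g * k) = f g) (g : G) :
    f (g : G ⧸ T.K n).out = f g := by
  obtain ⟨k, hk⟩ := QuotientGroup.mk_out_eq_mul (T.K n) g
  rw [hk, hf g k k.2]

theorem avg_eq_of_le {m n : ℕ} (hmn : m ≤ n) {f : G → ℝ}
    (hf : ∀ g, ∀ k ∈ T.K m, f (g * k) = f g) : T.avg n f = T.avg m f := by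
  let e := Subgroup.quotientEquivProdOfLE (T.anti hmn)
  have he : ∀ q : G ⧸ T.K n, f q.out = f (e q).1.out := by
    intro q
    induction q using QuotientGroup.induction_on with
    | H g =>
      rw [out_apply (fun g k hk => hf g k (T.anti hmn hk)) g]
      exact (out_apply hf g).symm
  have hne : (Nat.card ((T.K m) ⧸ (T.K n).subgroupOf (T.K m)) : ℝ) ≠ 0 := by
    have : ((T.K n).subgroupOf (T.K m)).FiniteIndex := inferInstance
    exact_mod_cast this.index_ne_zero
  have : Fintype ((T.K m) ⧸ (T.K n).subgroupOf (T.K m)) := Fintype.ofFinite _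
  rw [avg, avg, Finset.sum_congr rfl fun q _ => he q,
    Equiv.sum_comp e fun p => f p.1.out, Fintype.sum_prod_type, Nat.card_congr e, Nat.card_prod]
  simp only [Finset.sum_const, Finset.card_univ, nsmul_eq_mul, ← Finset.mul_sum]
  rw [← Nat.card_eq_fintype_card, Nat.cast_mul, mul_comm (Nat.card (G ⧸ T.K m) : ℝ),
    mul_div_mul_left _ _ hne]

theorem mean_eq_avg {n : ℕ} {f : G → ℝ} (hf : ∀ g, ∀ k ∈ T.K n, f (g * k) = f g) :
    T.mean f = T.avg n f := by
  refine Filter.Tendsto.limUnder_eq (tendsto_const_nhds.congr' ?_)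
  filter_upwards [Filter.eventually_ge_atTop n] with m hm
  exact (avg_eq_of_le hm hf).symm

theorem LocConst.exists_level {f f' : G → ℝ} (hf : T.LocConst f) (hf' : T.LocConst f') :
    ∃ n, (∀ g, ∀ k ∈ T.K n, f (g * k) = f g) ∧ ∀ g, ∀ k ∈ T.K n, f' (g * k) = f' g := by
  obtain ⟨n, hn⟩ := hf
  obtain ⟨n', hn'⟩ := hf'
  exact ⟨max n n', fun g k hk => hn g k (T.anti (le_max_left _ _) hk),
    fun g k hk => hn' g k (T.anti (le_max_right _ _) hk)⟩

theorem card_quotient_pos (n : ℕ) : (0 : ℝ) < Nat.card (G ⧸ T.K n) := by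
  exact_mod_cast Nat.card_pos

theorem mean_const (c : ℝ) : T.mean (fun _ => c) = c := by
  rw [mean_eq_avg (n := 0) fun _ _ _ => rfl, avg]
  have := (card_quotient_pos (T := T) 0).ne'
  simp only [Finset.sum_const, Finset.card_univ, nsmul_eq_mul, ← Nat.card_eq_fintype_card]
  field_simp

theorem mean_add {f f' : G → ℝ} (hf : T.LocConst f) (hf' : T.LocConst f') :
    T.mean (fun g => f g + f' g) = T.mean f + T.mean f' := by
  obtain ⟨n, hn, hn'⟩ := hf.exists_level hf'
  rw [mean_eq_avg hn, mean_eq_avg hn',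
    mean_eq_avg (n := n) fun g k hk => by rw [hn g k hk, hn' g k hk]]
  simp only [avg, Finset.sum_add_distrib, add_div]

theorem mean_const_mul (c : ℝ) {f : G → ℝ} (hf : T.LocConst f) :
    T.mean (fun g => c * f g) = c * T.mean f := by
  obtain ⟨n, hn⟩ := hf
  rw [mean_eq_avg hn, mean_eq_avg (n := n) fun g k hk => by rw [hn g k hk]]
  simp only [avg, ← Finset.mul_sum, mul_div_assoc]

theorem mean_sub {f f' : G → ℝ} (hf : T.LocConst f) (hf' : T.LocConst f') :
    T.mean (fun g => f g - f' g) = T.mean f - T.mean f' := by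
  rw [eq_sub_iff_add_eq, ← mean_add (hf.sub hf') hf']
  simp

theorem mean_sum {ι : Type*} (s : Finset ι) {f : ι → G → ℝ} (hf : ∀ i ∈ s, T.LocConst (f i)) :
    T.mean (fun g => ∑ i ∈ s, f i g) = ∑ i ∈ s, T.mean (f i) := by
  classical
  induction s using Finset.induction_on with
  | empty => simpa using mean_const 0
  | insert i s hi ih =>
    have hs : ∀ j ∈ s, T.LocConst (f j) := fun j hj => hf j (Finset.mem_insert_of_mem hj)
    simp only [Finset.sum_insert hi]
    rw [mean_add (hf i (Finset.mem_insert_self i s)) (LocConst.sum s hs), ih hs]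

theorem mean_mono {f f' : G → ℝ} (hf : T.LocConst f) (hf' : T.LocConst f') (h : ∀ g, f g ≤ f' g) :
    T.mean f ≤ T.mean f' := by
  obtain ⟨n, hn, hn'⟩ := hf.exists_level hf'
  rw [mean_eq_avg hn, mean_eq_avg hn']
  exact div_le_div_of_nonneg_right (Finset.sum_le_sum fun q _ => h _) (card_quotient_pos n).le

theorem mean_nonneg {f : G → ℝ} (hf : T.LocConst f) (h : ∀ g, 0 ≤ f g) : 0 ≤ T.mean f := by
  rw [← mean_const (T := T) 0]
  exact mean_mono (locConst_const 0) hf h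

theorem mean_mul_right {f : G → ℝ} (hf : T.LocConst f) (h : G) :
    T.mean (fun g => f (g * h)) = T.mean f := by
  obtain ⟨n, hn⟩ := hf
  have hn' : ∀ g, ∀ k ∈ T.K n, f (g * k * h) = f (g * h) := by
    intro g k hk
    have hk' := (T.normal n).conj_mem k hk h⁻¹
    rw [inv_inv] at hk'
    rw [← hn (g * h) _ hk']
    simp [mul_assoc]
  rw [mean_eq_avg hn, mean_eq_avg hn', avg, avg,
    ← Equiv.sum_comp (Equiv.mulRight (h : G ⧸ T.K n)) fun q => f q.out]
  congr 1
  refine Finset.sum_congr rfl fun q _ => ?_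
  induction q using QuotientGroup.induction_on with
  | H g =>
    rw [out_apply (f := fun g => f (g * h)) hn' g]
    exact (out_apply hn (g * h)).symm

theorem mean_mul_left {f : G → ℝ} (hf : T.LocConst f) (h : G) :
    T.mean (fun g => f (h * g)) = T.mean f := by
  obtain ⟨n, hn⟩ := hf
  have hn' : ∀ g, ∀ k ∈ T.K n, f (h * (g * k)) = f (h * g) := fun g k hk => by
    rw [← mul_assoc, hn _ k hk]
  rw [mean_eq_avg hn, mean_eq_avg hn', avg, avg,
    ← Equiv.sum_comp (Equiv.mulLeft (h : G ⧸ T.K n)) fun q => f q.out]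
  congr 1
  refine Finset.sum_congr rfl fun q _ => ?_
  induction q using QuotientGroup.induction_on with
  | H g =>
    rw [out_apply (f := fun g => f (h * g)) hn' g]
    exact (out_apply hn (h * g)).symm

/-- The proportion of the elements of the group that satisfy a locally constant predicate. -/
noncomputable def prob (T : NormalTower G) (p : G → Prop) : ℝ := T.mean fun g => ind (p g)

theorem LocConst.ind {p : G → Prop} (hp : T.LocConst p) : T.LocConst fun g => ind (p g) :=
  hp.comp _root_.ind

theorem prob_mono {p q : G → Prop} (hp : T.LocConst p) (hq : T.LocConst q) (h : ∀ g, p g → q g) :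
    T.prob p ≤ T.prob q := mean_mono hp.ind hq.ind fun g => ind_mono (h g)

theorem prob_nonneg {p : G → Prop} (hp : T.LocConst p) : 0 ≤ T.prob p :=
  mean_nonneg hp.ind fun _ => ind_nonneg _

theorem prob_mul_right {p : G → Prop} (hp : T.LocConst p) (h : G) :
    T.prob (fun g => p (g * h)) = T.prob p := mean_mul_right hp.ind h

theorem prob_le_sum {ι : Type*} (s : Finset ι) {p : G → Prop} {q : ι → G → Prop} (hp : T.LocConst p)
    (hq : ∀ i ∈ s, T.LocConst (q i)) (h : ∀ g, p g → ∃ i ∈ s, q i g) :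
    T.prob p ≤ ∑ i ∈ s, T.prob (q i) := by
  simp only [prob]
  rw [← mean_sum s fun i hi => (hq i hi).ind]
  exact mean_mono hp.ind (LocConst.sum s fun i hi => (hq i hi).ind) fun g => ind_le_sum s (h g)

theorem prob_or_le {p q r : G → Prop} (hp : T.LocConst p) (hq : T.LocConst q) (hr : T.LocConst r)
    (h : ∀ g, p g → q g ∨ r g) : T.prob p ≤ T.prob q + T.prob r := by
  have := prob_le_sum (T := T) (Finset.univ : Finset Bool) (q := fun b => if b then q else r) hp
    (fun b _ => by cases b <;> simpa) fun g hg => by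
      rcases h g hg with h | h
      · exact ⟨true, Finset.mem_univ _, h⟩
      · exact ⟨false, Finset.mem_univ _, h⟩
  simpa using this

end NormalTower

/-! ### Equidistribution of restrictions and the martingale of fixed vertices -/

namespace InvertibleAutomaton

open TreeAut NormalTower

variable {S X : Type*} (A : InvertibleAutomaton S X)

/-- The restriction, as a map from the group of an automaton to itself. -/
def res (v : List X) (g : A.group) : A.group := ⟨restrict g.1 v, restrict_mem_group g.2 v⟩

variable {A}

theorem res_mul (v : List X) (g h : A.group) : A.res v (g * h) = A.res (h.1.1 v) g * A.res v h :=
  Subtype.ext (restrict_mul g.1 h.1 v)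

variable [Fintype X]

variable (A) in
/-- The stabilisers of the levels in the group of an automaton. -/
def tower : NormalTower A.group where
  K n := (levelStab X n).subgroupOf A.group
  anti _ _ h := Subgroup.comap_mono (levelStab_antitone h)
  normal _ := inferInstance
  finiteIndex n := by
    have : (levelStab X n).FiniteIndex := Subgroup.finiteIndex_ker _
    infer_instance

theorem coe_fixCount (n : ℕ) (g : TreeAut X) :
    (fixCount n g : ℝ) = ∑ v : Word X n, ind (g.1 v.1 = v.1) := by
  classical
  rw [fixCount, Finset.card_filter, Nat.cast_sum]
  refine Finset.sum_congr rfl fun v _ => ?_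
  unfold ind
  split_ifs <;> simp

theorem mem_tower {n : ℕ} {g : A.group} : g ∈ A.tower.K n ↔ g.1 ∈ levelStab X n := Iff.rfl

theorem apply_of_mem_tower {n : ℕ} {g : A.group} (hg : g ∈ A.tower.K n) {v : List X}
    (hv : v.length = n) : g.1.1 v = v := mem_levelStab.1 hg v hv

theorem res_mem_tower {n : ℕ} {v : List X} {g : A.group} (hg : g ∈ A.tower.K (v.length + n)) :
    A.res v g ∈ A.tower.K n := by
  rw [mem_tower, mem_levelStab] at hg ⊢
  exact fun w hw => (fixed_of_append (hg (v ++ w) (by simp [hw]))).2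

theorem locConst_apply (v : List X) : A.tower.LocConst fun g => g.1.1 v :=
  ⟨v.length, fun g k hk => by
    change g.1.1 (k.1.1 v) = _
    rw [apply_of_mem_tower hk rfl]⟩

theorem locConst_apply_eq (v w : List X) : A.tower.LocConst fun g => g.1.1 v = w :=
  (locConst_apply v).comp fun u => u = w

theorem fixCount_mul_of_mem_tower {n : ℕ} (g : A.group) {k : A.group} (hk : k ∈ A.tower.K n) :
    fixCount n (g * k).1 = fixCount n g.1 := fixCount_mul_of_mem_levelStab g.1 hk

theorem locConst_fixCount (n : ℕ) : A.tower.LocConst fun g => fixCount n g.1 :=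
  ⟨n, fun g _ hk => fixCount_mul_of_mem_tower g hk⟩

theorem _root_.NormalTower.LocConst.comp_res {β : Type*} {f : A.group → β} (hf : A.tower.LocConst f)
    (v : List X) : A.tower.LocConst fun g => f (A.res v g) := by
  obtain ⟨n, hn⟩ := hf
  refine ⟨v.length + n, fun g k hk => ?_⟩
  have hkv : k.1.1 v = v := apply_of_mem_tower (A.tower.anti (Nat.le_add_right _ _) hk) rfl
  change f (A.res v (g * k)) = _
  rw [res_mul, hkv, hn _ _ (res_mem_tower hk)]

/-- A normal subgroup of the group of an automaton that is transitive on the levels and that consists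
of restrictions, at any given vertex, of its elements that stabilise the level of the vertex. -/
structure IsSelfReplicatingNormal (H : Subgroup A.group) : Prop where
  normal : H.Normal
  transitive : ∀ u v : List X, u.length = v.length → ∃ s ∈ H, s.1.1 u = v
  lift : ∀ v : List X, ∀ s ∈ H, ∃ t ∈ H, t ∈ A.tower.K v.length ∧ A.res v t = s

namespace IsPolynomialLike

variable [DecidableEq X] (hA : A.IsPolynomialLike)

include hA

theorem prob_apply_eq {v : List X} : A.tower.prob (fun g => g.1.1 v = v) =
    ((Fintype.card X : ℝ) ^ v.length)⁻¹ := by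
  have hone : ∑ w : Word X v.length, A.tower.prob (fun g => g.1.1 v = w.1) = 1 := by
    simp only [prob]
    rw [← mean_sum _ fun w _ => (locConst_apply_eq v w.1).ind, ← mean_const (T := A.tower) 1]
    congr 1
    funext g
    rw [Finset.sum_eq_single ⟨g.1.1 v, length_apply _ _⟩]
    · exact ind_of rfl
    · exact fun w _ hw => ind_of_not fun h => hw (Subtype.ext h.symm)
    · simp
  have heq : ∀ w : Word X v.length,
      A.tower.prob (fun g => g.1.1 v = w.1) = A.tower.prob (fun g => g.1.1 v = v) := by
    intro w
    obtain ⟨u, hu, huv, -⟩ := hA.exists_move_word w.2.symm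
    rw [prob, ← mean_mul_left (locConst_apply_eq v w.1).ind ⟨u, hu⟩]
    congr 1
    funext g
    have : (u * g.1).1 v = w.1 ↔ g.1.1 v = v := by
      rw [TreeAut.mul_apply, ← huv, u.1.injective.eq_iff]
    exact congrArg ind (propext this)
  rw [Finset.sum_congr rfl fun w _ => heq w, Finset.sum_const, Finset.card_univ, Word.card,
    nsmul_eq_mul, Nat.cast_pow] at hone
  exact eq_inv_of_mul_eq_one_right hone

/-- The restriction at `v` of a random element of the stabiliser of `v` is equidistributed. -/
theorem mean_fixed_res {f : A.group → ℝ} (hf : A.tower.LocConst f) (v : List X) :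
    A.tower.mean (fun g => ind (g.1.1 v = v) * f (A.res v g)) =
      ((Fintype.card X : ℝ) ^ v.length)⁻¹ * A.tower.mean f := by
  have hF : ∀ f : A.group → ℝ, A.tower.LocConst f →
      A.tower.LocConst fun g => ind (g.1.1 v = v) * f (A.res v g) := fun f hf =>
    (locConst_apply_eq v v).ind.mul (hf.comp_res v)
  -- left translation by an element with restriction `h`
  have htrans : ∀ h : A.group, A.tower.mean (fun g => ind (g.1.1 v = v) * f (h * A.res v g)) =
      A.tower.mean (fun g => ind (g.1.1 v = v) * f (A.res v g)) := by
    intro h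
    obtain ⟨p, hp, hpv, hph⟩ := hA.exists_fix_word v h.2
    rw [← mean_mul_left (hF f hf) ⟨p, hp⟩]
    congr 1
    funext g
    have hiff : ((⟨p, hp⟩ : A.group) * g).1.1 v = v ↔ g.1.1 v = v := by
      change p.1 (g.1.1 v) = v ↔ _
      conv_lhs => rw [← hpv]
      rw [p.1.injective.eq_iff, hpv]
    by_cases hg : g.1.1 v = v
    · rw [ind_of hg, ind_of (hiff.2 hg), res_mul, hg]
      congr 3
      exact Subtype.ext hph.symm
    · rw [ind_of_not hg, ind_of_not fun h => hg (hiff.1 h), zero_mul, zero_mul]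
  obtain ⟨n, hn⟩ := id hf
  have hcard := card_quotient_pos (T := A.tower) n
  have hsum : ∑ q : A.group ⧸ A.tower.K n,
      A.tower.mean (fun g => ind (g.1.1 v = v) * f (q.out * A.res v g)) =
      Nat.card (A.group ⧸ A.tower.K n) *
        (((Fintype.card X : ℝ) ^ v.length)⁻¹ * A.tower.mean f) := by
    rw [← mean_sum _ fun (q : A.group ⧸ A.tower.K n) _ => hF _ (hf.mul_left q.out),
      ← hA.prob_apply_eq, prob, ← mul_assoc, mul_comm, ← mul_assoc, ← mean_const_mul _ (locConst_apply_eq v v).ind]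
    congr 1
    funext g
    by_cases hg : g.1.1 v = v
    · simp only [ind_of hg, one_mul, mul_one]
      rw [← mean_mul_right hf (A.res v g), mean_eq_avg (n := n), avg, div_mul_cancel₀ _ hcard.ne']
      intro h k hk
      have hk' := (A.tower.normal n).conj_mem k hk (A.res v g)⁻¹
      rw [inv_inv] at hk'
      have := hn (h * A.res v g) _ hk'
      rwa [show h * A.res v g * ((A.res v g)⁻¹ * k * A.res v g) = h * k * A.res v g by group] at this
    · simp [ind_of_not hg]
  rw [Finset.sum_congr rfl fun q _ => htrans q.out, Finset.sum_const, Finset.card_univ, nsmul_eq_mul,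
    ← Nat.card_eq_fintype_card] at hsum
  exact mul_left_cancel₀ hcard.ne' hsum

theorem prob_fixed_res {p : A.group → Prop} (hp : A.tower.LocConst p) (v : List X) :
    A.tower.prob (fun g => g.1.1 v = v ∧ p (A.res v g)) =
      ((Fintype.card X : ℝ) ^ v.length)⁻¹ * A.tower.prob p := by
  simp only [prob, ind_and]
  exact hA.mean_fixed_res hp.ind v

end IsPolynomialLike

namespace IsSelfReplicatingNormal

variable {H : Subgroup A.group} (hH : IsSelfReplicatingNormal H)

include hH

/-- The number of fixed vertices is a martingale. -/
theorem mean_fixCount_mul [Nonempty X] (n k : ℕ) {ψ : A.group → ℝ}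
    (hψ : ∀ g, ∀ t ∈ A.tower.K n, ψ (g * t) = ψ g) :
    A.tower.mean (fun g => fixCount (n + k) g.1 * ψ g) =
      A.tower.mean (fun g => fixCount n g.1 * ψ g) := by
  have hψ' : A.tower.LocConst ψ := ⟨n, hψ⟩
  have hF : ∀ u v : List X, A.tower.LocConst fun g => ind (g.1.1 u = v) * ψ g :=
    fun u v => (locConst_apply_eq u v).ind.mul hψ'
  have hcount : ∀ m, (fun g : A.group => (fixCount m g.1 : ℝ) * ψ g) =
      fun g => ∑ u : Word X m, ind (g.1.1 u.1 = u.1) * ψ g := by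
    intro m
    funext g
    rw [← Finset.sum_mul, coe_fixCount]
  rw [hcount, hcount, mean_sum _ fun u _ => hF u.1 u.1, mean_sum _ fun u _ => hF u.1 u.1,
    ← Equiv.sum_comp (Word.appendEquiv X n k), Fintype.sum_prod_type]
  refine Finset.sum_congr rfl fun v _ => ?_
  let w₀ : Word X k := ⟨List.replicate k (Classical.arbitrary X), List.length_replicate⟩
  -- elements of `H` stabilising the level `n` act transitively below `v`
  have hmove : ∀ w : Word X k,
      A.tower.mean (fun g => ind (g.1.1 (v.1 ++ w.1) = v.1 ++ w.1) * ψ g) =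
      A.tower.mean (fun g => ind (g.1.1 (v.1 ++ w₀.1) = v.1 ++ w.1) * ψ g) := by
    intro w
    obtain ⟨s, hs, hsw⟩ := hH.transitive w₀.1 w.1 (w₀.2.trans w.2.symm)
    obtain ⟨t, -, htn, hts⟩ := hH.lift v.1 s hs
    have ht : t.1.1 (v.1 ++ w₀.1) = v.1 ++ w.1 := by
      rw [apply_append_restrict, apply_of_mem_tower htn rfl,
        show restrict t.1 v.1 = s.1 from congrArg Subtype.val hts, hsw]
    rw [v.2] at htn
    refine Eq.trans ?_ (mean_mul_right (hF (v.1 ++ w₀.1) (v.1 ++ w.1)) t)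
    congr 1
    funext g
    change _ = ind (g.1.1 (t.1.1 (v.1 ++ w₀.1)) = v.1 ++ w.1) * ψ (g * t)
    rw [ht, hψ g t htn]
  refine (Finset.sum_congr rfl fun w _ => hmove w).trans ?_
  rw [← mean_sum _ fun w _ => hF _ _]
  congr 1
  funext g
  rw [← Finset.sum_mul]
  congr 1
  by_cases hg : g.1.1 v.1 = v.1
  · rw [ind_of hg, Finset.sum_eq_single ⟨(restrict g.1 v.1).1 w₀.1, (length_apply _ _).trans w₀.2⟩]
    · rw [ind_of (by rw [apply_append_restrict, hg])]
    · refine fun w _ hw => ind_of_not fun h => hw (Subtype.ext ?_)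
      rw [apply_append_restrict, hg] at h
      exact (List.append_cancel_left h).symm
    · simp
  · rw [ind_of_not hg]
    refine Finset.sum_eq_zero fun w _ => ind_of_not fun h => hg ?_
    rw [apply_append_restrict] at h
    exact (List.append_inj h (length_apply _ _)).1

end IsSelfReplicatingNormal

end InvertibleAutomaton

/-! ### Stabilisation of the number of fixed vertices -/

/-- Strict convexity of `x ↦ 1 / (1 + x)`: the difference to the tangent at `r` is
`(x - r) ^ 2 / ((1 + x) * (1 + r) ^ 2)`. -/
theorem ind_mul_le_inv_sub {r x R : ℕ} :
    ind (r ≤ R ∧ x ≠ r) * (((1 + R : ℝ) ^ 2 * (R + 2))⁻¹) ≤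
      (1 + x : ℝ)⁻¹ - (1 + r : ℝ)⁻¹ + (x * ((1 + r : ℝ) ^ 2)⁻¹ - r * ((1 + r : ℝ) ^ 2)⁻¹) := by
  have key : (1 + x : ℝ)⁻¹ - (1 + r : ℝ)⁻¹ + (x * ((1 + r : ℝ) ^ 2)⁻¹ - r * ((1 + r : ℝ) ^ 2)⁻¹) =
      ((x : ℝ) - r) ^ 2 / (1 + x) * ((1 + r : ℝ) ^ 2)⁻¹ := by
    field_simp
    ring
  rw [key]
  by_cases h : r ≤ R ∧ x ≠ r
  · rw [ind_of h, one_mul, mul_inv, mul_comm]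
    have hr : (r : ℝ) ≤ R := by exact_mod_cast h.1
    refine mul_le_mul ?_ ?_ (by positivity) (by positivity)
    · rw [le_div_iff₀ (by positivity), inv_mul_le_iff₀ (by positivity)]
      have hx0 : (0 : ℝ) ≤ x := by positivity
      have hr0 : (0 : ℝ) ≤ r := by positivity
      rcases lt_or_gt_of_ne h.2 with hlt | hlt
      · have : (x : ℝ) + 1 ≤ r := by exact_mod_cast hlt
        have h1 : 1 ≤ ((x : ℝ) - r) ^ 2 := by nlinarith
        nlinarith [mul_le_mul_of_nonneg_left h1 (by positivity : (0 : ℝ) ≤ R + 2)]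
      · have : (r : ℝ) + 1 ≤ x := by exact_mod_cast hlt
        have h1 : (x : ℝ) - r ≤ ((x : ℝ) - r) ^ 2 := by nlinarith
        nlinarith [mul_le_mul_of_nonneg_left h1 (by positivity : (0 : ℝ) ≤ R + 2),
          mul_le_mul_of_nonneg_right hr (by linarith : (0 : ℝ) ≤ (x : ℝ) - r)]
    · exact inv_anti₀ (by positivity) (by gcongr)
  · rw [ind_of_not h, zero_mul]
    positivity

namespace InvertibleAutomaton

open TreeAut NormalTower

variable {S X : Type*} [Fintype X] {A : InvertibleAutomaton S X}

namespace IsSelfReplicatingNormal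

variable {H : Subgroup A.group} (hH : IsSelfReplicatingNormal H)

include hH

theorem mean_fixCount [Nonempty X] (n : ℕ) : A.tower.mean (fun g => fixCount n g.1) = 1 := by
  have h := hH.mean_fixCount_mul 0 n (ψ := fun _ => 1) fun _ _ _ => rfl
  have h0 : ∀ g : A.group, (fixCount 0 g.1 : ℝ) * 1 = 1 := by
    intro g
    have : g.1 ∈ levelStab X 0 := mem_levelStab.2 fun v hv => by
      rw [List.length_eq_zero_iff] at hv
      rw [hv, apply_nil]
    rw [fixCount_of_mem_levelStab this]
    simp
  rw [Nat.zero_add, funext h0, mean_const] at h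
  simpa using h

theorem prob_lt_fixCount_le [Nonempty X] (n : ℕ) {R : ℕ} (hR : 0 < R) :
    A.tower.prob (fun g => R < fixCount n g.1) ≤ (R : ℝ)⁻¹ := by
  have hR' : (0 : ℝ) < R := by exact_mod_cast hR
  have hX : A.tower.LocConst fun g => (fixCount n g.1 : ℝ) :=
    (locConst_fixCount n).comp fun m : ℕ => (m : ℝ)
  have hp : A.tower.LocConst fun g => R < fixCount n g.1 :=
    (locConst_fixCount n).comp fun m => R < m
  rw [← mul_one (R : ℝ)⁻¹, ← hH.mean_fixCount n, ← mean_const_mul _ hX]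
  refine mean_mono hp.ind ((locConst_const _).mul hX) fun g => ?_
  by_cases h : R < fixCount n g.1
  · rw [ind_of h, inv_mul_eq_div, one_le_div hR']
    exact_mod_cast h.le
  · rw [ind_of_not h]
    positivity

theorem prob_fixCount_ne_le [Nonempty X] (n k R : ℕ) :
    A.tower.prob (fun g => fixCount n g.1 ≤ R ∧ fixCount (n + k) g.1 ≠ fixCount n g.1) *
        (((1 + R : ℝ) ^ 2 * (R + 2))⁻¹) ≤
      A.tower.mean (fun g => (1 + fixCount (n + k) g.1 : ℝ)⁻¹) -
        A.tower.mean (fun g => (1 + fixCount n g.1 : ℝ)⁻¹) := by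
  have hinv : ∀ m, A.tower.LocConst fun g => (1 + fixCount m g.1 : ℝ)⁻¹ := fun m =>
    (locConst_fixCount m).comp fun i : ℕ => (1 + i : ℝ)⁻¹
  have hX : ∀ m, A.tower.LocConst fun g => (fixCount m g.1 : ℝ) := fun m =>
    (locConst_fixCount m).comp fun i : ℕ => (i : ℝ)
  have hψ : A.tower.LocConst fun g => ((1 + fixCount n g.1 : ℝ) ^ 2)⁻¹ :=
    (locConst_fixCount n).comp fun i : ℕ => ((1 + i : ℝ) ^ 2)⁻¹
  have hp : A.tower.LocConst fun g =>
      fixCount n g.1 ≤ R ∧ fixCount (n + k) g.1 ≠ fixCount n g.1 :=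
    (locConst_fixCount n).comp₂ (locConst_fixCount (n + k)) fun i j => i ≤ R ∧ j ≠ i
  have hmart := hH.mean_fixCount_mul n k (ψ := fun g => ((1 + fixCount n g.1 : ℝ) ^ 2)⁻¹)
    fun g t ht => by rw [fixCount_mul_of_mem_tower g ht]
  rw [mul_comm, prob, ← mean_const_mul _ hp.ind, ← add_zero (_ - _), ← sub_eq_zero.2 hmart,
    ← mean_sub (hinv _) (hinv _), ← mean_sub ((hX _).mul hψ) ((hX _).mul hψ),
    ← mean_add ((hinv _).sub (hinv _)) (((hX _).mul hψ).sub ((hX _).mul hψ))]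
  refine mean_mono ((locConst_const _).mul hp.ind)
    (((hinv _).sub (hinv _)).add (((hX _).mul hψ).sub ((hX _).mul hψ))) fun g => ?_
  rw [mul_comm]
  exact ind_mul_le_inv_sub

/-- The number of fixed vertices is eventually constant, with probability tending to one: the means
of `1 / (1 + fixCount n)` are increasing and bounded. -/
theorem tendsto_prob_fixCount_ne [Nonempty X] (k R : ℕ) :
    Filter.Tendsto (fun n => A.tower.prob fun g =>
      fixCount n g.1 ≤ R ∧ fixCount (n + k) g.1 ≠ fixCount n g.1) Filter.atTop (nhds 0) := by
  let a : ℕ → ℝ := fun n => A.tower.mean fun g => (1 + fixCount n g.1 : ℝ)⁻¹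
  have hp : ∀ n k R, A.tower.LocConst fun g =>
      fixCount n g.1 ≤ R ∧ fixCount (n + k) g.1 ≠ fixCount n g.1 := fun n k R =>
    (locConst_fixCount n).comp₂ (locConst_fixCount (n + k)) fun i j => i ≤ R ∧ j ≠ i
  have hmono : Monotone a := monotone_nat_of_le_succ fun n => by
    have h := hH.prob_fixCount_ne_le n 1 0
    have h' := prob_nonneg (hp n 1 0)
    have : (0 : ℝ) ≤ a (n + 1) - a n := le_trans (by positivity) h
    linarith
  have hbdd : BddAbove (Set.range a) := by
    refine ⟨1, ?_⟩
    rintro _ ⟨n, rfl⟩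
    rw [← mean_const (T := A.tower) 1]
    refine mean_mono ((locConst_fixCount n).comp fun i : ℕ => (1 + i : ℝ)⁻¹) (locConst_const _)
      fun g => inv_le_one_of_one_le₀ ?_
    linarith [(Nat.cast_nonneg (fixCount n g.1) : (0 : ℝ) ≤ _)]
  have hlim := tendsto_atTop_ciSup hmono hbdd
  have hdiff : Filter.Tendsto (fun n => (a (n + k) - a n) * ((1 + R : ℝ) ^ 2 * (R + 2)))
      Filter.atTop (nhds 0) := by
    have := ((hlim.comp (Filter.tendsto_add_atTop_nat k)).sub hlim).mul_const
      ((1 + R : ℝ) ^ 2 * (R + 2))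
    simpa using this
  refine squeeze_zero (fun n => prob_nonneg (hp n k R)) (fun n => ?_) hdiff
  have h := hH.prob_fixCount_ne_le n k R
  rwa [← div_eq_mul_inv, div_le_iff₀ (by positivity)] at h

/-- The mean value of a function that is invariant under `H` is not changed by restricting it to the
stabiliser of a vertex, as `H` is transitive. -/
theorem mean_ind_fixed_mul {f : A.group → ℝ} (hf : A.tower.LocConst f)
    (hinv : ∀ g, ∀ s ∈ H, f (g * s) = f g) (v : List X) :
    (Fintype.card X : ℝ) ^ v.length * A.tower.mean (fun g => ind (g.1.1 v = v) * f g) =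
      A.tower.mean f := by
  have hF : ∀ w : List X, A.tower.LocConst fun g => ind (g.1.1 w = v) * f g := fun w =>
    (locConst_apply_eq w v).ind.mul hf
  have h1 : ∑ w : Word X v.length, A.tower.mean (fun g => ind (g.1.1 w.1 = v) * f g) =
      A.tower.mean f := by
    rw [← mean_sum _ fun w _ => hF w.1]
    congr 1
    funext g
    rw [← Finset.sum_mul, Finset.sum_eq_single ⟨(g⁻¹).1.1 v, length_apply _ _⟩]
    · rw [ind_of, one_mul]
      exact (g.1.1.apply_symm_apply v)
    · refine fun w _ hw => ind_of_not fun h => hw (Subtype.ext ?_)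
      exact (inv_apply_eq.2 h.symm).symm
    · simp
  rw [← h1]
  have h2 : ∀ w : Word X v.length, A.tower.mean (fun g => ind (g.1.1 w.1 = v) * f g) =
      A.tower.mean (fun g => ind (g.1.1 v = v) * f g) := by
    intro w
    obtain ⟨s, hs, hsw⟩ := hH.transitive v w.1 w.2.symm
    refine Eq.trans ?_ (mean_mul_right (hF v) s)
    congr 1
    funext g
    change _ = ind (g.1.1 (s.1.1 v) = v) * f (g * s)
    rw [hsw, hinv g s hs]
  rw [Finset.sum_congr rfl fun w _ => h2 w, Finset.sum_const, Finset.card_univ, Word.card,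
    nsmul_eq_mul, Nat.cast_pow]

end IsSelfReplicatingNormal

end InvertibleAutomaton

/-! ### Cosets with few fixed vertices -/

namespace InvertibleAutomaton

open TreeAut NormalTower Filter

variable {S X : Type*} [Fintype X] {A : InvertibleAutomaton S X}

/-- All elements of the coset `g H` have at most `R` fixed points on each of the levels up to `k`. -/
def FewFixed (H : Subgroup A.group) (R k : ℕ) (g : A.group) : Prop :=
  ∀ s ∈ H, ∀ j ≤ k, fixCount j (g * s).1 ≤ R

theorem FewFixed.anti {H : Subgroup A.group} {R k k' : ℕ} (hk : k ≤ k') {g : A.group}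
    (hg : FewFixed H R k' g) : FewFixed H R k g := fun s hs j hj => hg s hs j (hj.trans hk)

theorem fewFixed_mul_right {H : Subgroup A.group} {R k : ℕ} {g s : A.group} (hs : s ∈ H) :
    FewFixed H R k (g * s) ↔ FewFixed H R k g := by
  constructor
  · intro h t ht j hj
    have := h (s⁻¹ * t) (H.mul_mem (H.inv_mem hs) ht) j hj
    rwa [mul_assoc, mul_inv_cancel_left] at this
  · intro h t ht j hj
    rw [mul_assoc]
    exact h (s * t) (H.mul_mem hs ht) j hj

theorem FewFixed.mul_of_mem_tower {H : Subgroup A.group} {R k : ℕ} {g t : A.group}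
    (hg : FewFixed H R k g) (ht : t ∈ A.tower.K k) : FewFixed H R k (g * t) := by
  intro s hs j hj
  have ht' := (A.tower.normal k).conj_mem t ht s⁻¹
  rw [inv_inv] at ht'
  rw [show g * t * s = g * s * (s⁻¹ * t * s) by group,
    fixCount_mul_of_mem_tower _ (A.tower.anti hj ht')]
  exact hg s hs j hj

theorem locConst_fewFixed (H : Subgroup A.group) (R k : ℕ) : A.tower.LocConst (FewFixed H R k) := by
  refine ⟨k, fun g t ht => propext ⟨fun h => ?_, fun h => h.mul_of_mem_tower ht⟩⟩
  simpa using h.mul_of_mem_tower (inv_mem ht)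

/-- The vertex `v` of level `n` is fixed, at most `R` vertices of level `n` are fixed, but more than
`R` descendants of `v` of level `n + j` are. -/
def ManyBelow (R n j : ℕ) (v : Word X n) (g : A.group) : Prop :=
  g.1.1 v.1 = v.1 ∧ fixCount n g.1 ≤ R ∧ R < fixCount j (A.res v.1 g).1

theorem locConst_manyBelow (R n j : ℕ) (v : Word X n) :
    A.tower.LocConst (ManyBelow (A := A) R n j v) :=
  (locConst_apply_eq v.1 v.1).and (((locConst_fixCount n).comp fun i => i ≤ R).and
    (((locConst_fixCount j).comp fun i => R < i).comp_res v.1))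

/-- If some vertex of level `n` has many fixed descendants, then the number of fixed vertices changes
between the levels `n` and `n + j`, and there are at most `R` such vertices. -/
theorem sum_prob_manyBelow_le (n j R : ℕ) :
    ∑ v : Word X n, A.tower.prob (ManyBelow R n j v) ≤
      R * A.tower.prob (fun g => fixCount n g.1 ≤ R ∧ fixCount (n + j) g.1 ≠ fixCount n g.1) := by
  have hQ := fun v => (locConst_manyBelow (A := A) R n j v).ind
  have hp : A.tower.LocConst fun g =>
      fixCount n g.1 ≤ R ∧ fixCount (n + j) g.1 ≠ fixCount n g.1 :=
    (locConst_fixCount n).comp₂ (locConst_fixCount (n + j)) fun i j => i ≤ R ∧ j ≠ i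
  simp only [prob]
  rw [← mean_sum _ fun v _ => hQ v, ← mean_const_mul _ hp.ind]
  refine mean_mono (LocConst.sum _ fun v _ => hQ v) ((locConst_const _).mul hp.ind) fun g => ?_
  by_cases h : fixCount n g.1 ≤ R ∧ fixCount (n + j) g.1 ≠ fixCount n g.1
  · rw [ind_of h, mul_one]
    refine (Finset.sum_le_sum fun v _ => ind_mono And.left).trans ?_
    rw [← coe_fixCount]
    exact_mod_cast h.1
  · rw [ind_of_not h, mul_zero]
    refine (Finset.sum_eq_zero fun v _ => ind_of_not ?_).le
    rintro ⟨hv, hR, hR'⟩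
    refine h ⟨hR, ?_⟩
    have := fixCount_restrict_le hv j
    rw [v.2] at this
    exact (hR.trans_lt (hR'.trans_le this)).ne'

theorem exists_coset_representatives {G : Type*} [Group G] (H K : Subgroup G) :
    ∃ s : G ⧸ K → G, (∀ q, s q ∈ H) ∧ ∀ u ∈ H, (s u : G ⧸ K) = u := by
  have hrep : ∀ q : G ⧸ K, ∃ s ∈ H, (∃ u ∈ H, (u : G ⧸ K) = q) → (s : G ⧸ K) = q := by
    intro q
    by_cases h : ∃ u ∈ H, (u : G ⧸ K) = q
    · obtain ⟨s, hs, hsq⟩ := h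
      exact ⟨s, hs, fun _ => hsq⟩
    · exact ⟨1, H.one_mem, fun h' => absurd h' h⟩
  choose s hs hsq using hrep
  exact ⟨s, hs, fun u hu => hsq u ⟨u, hu, rfl⟩⟩

/-- If `g` fixes the vertex `v` but `g|_v H` has an element with many fixed points, then the product
of `g` with one of finitely many elements has many fixed points below `v`. -/
theorem exists_manyBelow {H : Subgroup A.group} {R k n : ℕ}
    {s : A.group ⧸ A.tower.K k → A.group} (hs : ∀ u ∈ H, (s u : A.group ⧸ A.tower.K k) = u)
    {v : Word X n} {t : A.group ⧸ A.tower.K k → A.group} (htK : ∀ q, t q ∈ A.tower.K n)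
    (htres : ∀ q, A.res v.1 (t q) = s q) {g : A.group} (hv : g.1.1 v.1 = v.1)
    (hR : fixCount n g.1 ≤ R) (hg : ¬FewFixed H R k (A.res v.1 g)) :
    ∃ (q : A.group ⧸ A.tower.K k) (j : Fin (k + 1)), ManyBelow R n j v (g * t q) := by
  unfold FewFixed at hg
  push Not at hg
  obtain ⟨u, hu, j, hj, huj⟩ := hg
  refine ⟨u, ⟨j, by omega⟩, ?_⟩
  have htv : (t u).1.1 v.1 = v.1 := apply_of_mem_tower (htK u) v.2
  refine ⟨?_, ?_, ?_⟩
  · change g.1.1 ((t u).1.1 v.1) = v.1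
    rw [htv, hv]
  · rwa [fixCount_mul_of_mem_tower g (htK u)]
  · change R < fixCount j _
    rw [res_mul, htv, htres]
    have hmem : u⁻¹ * s u ∈ A.tower.K k := QuotientGroup.eq.1 (hs u hu).symm
    have := fixCount_mul_of_mem_tower (A.res v.1 g * u) (A.tower.anti hj hmem)
    rw [mul_assoc, mul_inv_cancel_left] at this
    rwa [this]

theorem _root_.NormalTower.prob_and_not_symm {G : Type*} [Group G] {T : NormalTower G}
    {p q : G → Prop} (hp : T.LocConst p) (hq : T.LocConst q) (h : T.prob p = T.prob q) :
    T.prob (fun g => p g ∧ ¬q g) = T.prob fun g => q g ∧ ¬p g := by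
  rw [← sub_eq_zero] at h ⊢
  rw [← h, prob, prob, prob, prob, ← mean_sub (hp.and hq.not).ind (hq.and hp.not).ind,
    ← mean_sub hp.ind hq.ind]
  congr 1
  funext g
  by_cases hpg : p g <;> by_cases hqg : q g <;> simp [ind, hpg, hqg]

/-- The elements that asymptotically preserve the set of cosets with few fixed points. -/
def almostPreserving (H : Subgroup A.group) (R : ℕ) : Subgroup A.group where
  carrier := {g | Tendsto (fun m => A.tower.prob fun h => FewFixed H R m h ∧ ¬FewFixed H R m (h * g))
    atTop (nhds 0)}
  one_mem' := by
    have : ∀ m, A.tower.prob (fun h => FewFixed H R m h ∧ ¬FewFixed H R m (h * 1)) = 0 := by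
      intro m
      rw [prob, ← mean_const (T := A.tower) 0]
      congr 1
      funext h
      exact ind_of_not fun hh => hh.2 (by rw [mul_one]; exact hh.1)
    simp only [Set.mem_ofPred_eq, this, tendsto_const_nhds]
  mul_mem' := by
    intro a b ha hb
    simp only [Set.mem_ofPred_eq] at ha hb ⊢
    have hlim := ha.add hb
    rw [add_zero] at hlim
    have hY := locConst_fewFixed H R
    refine squeeze_zero (fun m => prob_nonneg ((hY m).and ((hY m).mul_right _).not)) (fun m => ?_) hlim
    have hE := (hY m).and ((hY m).mul_right b).not
    rw [← prob_mul_right hE a]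
    refine prob_or_le ((hY m).and ((hY m).mul_right _).not) ((hY m).and ((hY m).mul_right a).not)
      (hE.mul_right a) fun h hh => ?_
    by_cases hc : FewFixed H R m (h * a)
    · exact Or.inr ⟨hc, by rw [mul_assoc]; exact hh.2⟩
    · exact Or.inl ⟨hh.1, hc⟩
  inv_mem' := by
    intro a ha
    simp only [Set.mem_ofPred_eq] at ha ⊢
    refine ha.congr fun m => ?_
    have hY := locConst_fewFixed H R m
    rw [← prob_mul_right (hY.and (hY.mul_right a⁻¹).not) a,
      prob_and_not_symm hY (hY.mul_right a) (prob_mul_right hY a).symm]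
    simp only [mul_inv_cancel_right]

/-- If the set of the cosets with few fixed points is asymptotically invariant under all right
translations, then such cosets become rare: one of the translates of any element by finitely many
elements fixes too many vertices of a given level. -/
theorem tendsto_prob_fewFixed {R : ℕ} (hX : 2 ≤ Fintype.card X) (hI : almostPreserving H R = ⊤) :
    Tendsto (fun m => A.tower.prob (FewFixed H R m)) atTop (nhds 0) := by
  obtain ⟨M, hM⟩ : ∃ M, R < Fintype.card X ^ M := ⟨R, Nat.lt_pow_self hX⟩
  have hY := locConst_fewFixed H R
  have hlim : Tendsto (fun m => ∑ q : A.group ⧸ A.tower.K M, A.tower.prob fun h =>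
      FewFixed H R m h ∧ ¬FewFixed H R m (h * q.out⁻¹)) atTop
      (nhds (∑ _q : A.group ⧸ A.tower.K M, 0)) := by
    refine tendsto_finsetSum _ fun q _ => ?_
    have : q.out⁻¹ ∈ almostPreserving H R := hI ▸ Subgroup.mem_top _
    exact this
  rw [Finset.sum_const_zero] at hlim
  refine squeeze_zero' (Eventually.of_forall fun m => prob_nonneg (hY m)) ?_ hlim
  filter_upwards [eventually_ge_atTop M] with m hm
  refine prob_le_sum _ (hY m) (fun q _ => (hY m).and ((hY m).mul_right _).not) fun h hh =>
    ⟨(h : A.group ⧸ A.tower.K M), Finset.mem_univ _, hh, fun hc => ?_⟩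
  obtain ⟨k, hk⟩ := QuotientGroup.mk_out_eq_mul (A.tower.K M) h
  have hmem : h * ((h : A.group ⧸ A.tower.K M)).out⁻¹ ∈ A.tower.K M := by
    rw [hk, mul_inv_rev, ← mul_assoc]
    exact (A.tower.normal M).conj_mem _ (inv_mem k.2) h
  have := hc 1 H.one_mem M hm
  rw [mul_one, fixCount_of_mem_levelStab (mem_tower.1 hmem)] at this
  omega

namespace IsSelfReplicatingNormal

variable {H : Subgroup A.group} (hH : IsSelfReplicatingNormal H)

include hH

theorem fewFixed_res {R k : ℕ} {w : List X} {g : A.group} (hg : FewFixed H R (w.length + k) g)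
    (hw : g.1.1 w = w) : FewFixed H R k (A.res w g) := by
  intro s hs j hj
  obtain ⟨t, ht, htw, rfl⟩ := hH.lift w s hs
  have htw' : t.1.1 w = w := apply_of_mem_tower htw rfl
  have hgt : (g * t).1.1 w = w := by
    change g.1.1 (t.1.1 w) = w
    rw [htw', hw]
  have hres : A.res w g * A.res w t = A.res w (g * t) := by rw [res_mul, htw']
  rw [hres]
  exact (fixCount_restrict_le hgt j).trans (hg t ht _ (by omega))

/-- An element with fixed points on the level `n` has many of them, or restricts to a coset with few
fixed points, or is close to an element with many fixed points below a vertex of level `n`. -/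
theorem prob_fixCount_pos_le [DecidableEq X] [Nonempty X] (hA : A.IsPolynomialLike) {R : ℕ}
    (hR : 0 < R) (k n : ℕ) :
    A.tower.prob (fun g => 0 < fixCount n g.1) ≤
      (R : ℝ)⁻¹ + (A.tower.prob (FewFixed H R k) +
        ∑ _q : A.group ⧸ A.tower.K k, ∑ j : Fin (k + 1), R * A.tower.prob (fun g =>
          fixCount n g.1 ≤ R ∧ fixCount (n + j) g.1 ≠ fixCount n g.1)) := by
  obtain ⟨s, hsH, hs⟩ := exists_coset_representatives H (A.tower.K k)
  have hlift : ∀ (v : Word X n) (q : A.group ⧸ A.tower.K k),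
      ∃ t, t ∈ A.tower.K n ∧ A.res v.1 t = s q := by
    intro v q
    obtain ⟨t, -, ht, htr⟩ := hH.lift v.1 _ (hsH q)
    rw [v.2] at ht
    exact ⟨t, ht, htr⟩
  choose t htK htres using hlift
  let B : (v : Word X n) → A.group → Prop := fun v g =>
    g.1.1 v.1 = v.1 ∧ FewFixed H R k (A.res v.1 g)
  have hB : ∀ v, A.tower.LocConst (B v) := fun v =>
    (locConst_apply_eq v.1 v.1).and ((locConst_fewFixed H R k).comp_res v.1)
  let C : A.group ⧸ A.tower.K k → Fin (k + 1) → Word X n → A.group → Prop := fun q j v g =>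
    ManyBelow R n j v (g * t v q)
  have hC : ∀ q j v, A.tower.LocConst (C q j v) := fun q j v =>
    (locConst_manyBelow R n j v).mul_right _
  let ι := Unit ⊕ Word X n ⊕ (A.group ⧸ A.tower.K k) × Fin (k + 1) × Word X n
  let E : ι → A.group → Prop := Sum.elim (fun _ g => R < fixCount n g.1)
    (Sum.elim B fun i => C i.1 i.2.1 i.2.2)
  have hE : ∀ i, A.tower.LocConst (E i) := by
    rintro (_ | v | i)
    · exact (locConst_fixCount n).comp fun i => R < i
    · exact hB v
    · exact hC _ _ _
  have hsum := prob_le_sum (T := A.tower) Finset.univ (q := E)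
    ((locConst_fixCount n).comp fun i => 0 < i) (fun i _ => hE i) fun g hg => by
      obtain ⟨v, hv⟩ := fixCount_pos_iff.1 hg
      by_cases h1 : R < fixCount n g.1
      · exact ⟨Sum.inl (), Finset.mem_univ _, h1⟩
      by_cases h2 : FewFixed H R k (A.res v.1 g)
      · exact ⟨Sum.inr (Sum.inl v), Finset.mem_univ _, hv, h2⟩
      · obtain ⟨q, j, hqj⟩ := exists_manyBelow hs (htK v) (htres v) hv (not_lt.1 h1) h2
        exact ⟨Sum.inr (Sum.inr (q, j, v)), Finset.mem_univ _, hqj⟩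
  rw [Fintype.sum_sum_type, Fintype.sum_sum_type, Fintype.sum_prod_type, Fintype.sum_unique] at hsum
  refine hsum.trans (add_le_add (hH.prob_lt_fixCount_le n hR) (add_le_add ?_ ?_))
  · have hd : ((Fintype.card X : ℝ) ^ n) ≠ 0 := by
      have : Fintype.card X ≠ 0 := Fintype.card_ne_zero
      positivity
    have hv : ∀ v : Word X n, A.tower.prob (B v) =
        ((Fintype.card X : ℝ) ^ n)⁻¹ * A.tower.prob (FewFixed H R k) := by
      intro v
      have := hA.prob_fixed_res (locConst_fewFixed H R k) v.1
      rwa [v.2] at this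
    refine (Finset.sum_congr rfl fun v _ => hv v).trans_le ?_
    rw [Finset.sum_const, Finset.card_univ, Word.card, nsmul_eq_mul, Nat.cast_pow,
      mul_inv_cancel_left₀ hd]
  · refine Finset.sum_le_sum fun q _ => ?_
    rw [Fintype.sum_prod_type]
    refine Finset.sum_le_sum fun j _ => ?_
    refine le_trans (le_of_eq ?_) (sum_prob_manyBelow_le n j R)
    exact Finset.sum_congr rfl fun v _ => prob_mul_right (locConst_manyBelow R n j v) (t v q)

/-- If the proportion of the elements with fixed points is bounded below on all levels, then so is
the proportion of the cosets of `H` with few fixed points: a random element that fixes a vertex of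
high level restricts at this vertex to such a coset with high probability. -/
theorem sub_inv_le_prob_fewFixed [DecidableEq X] [Nonempty X] (hA : A.IsPolynomialLike)
    {F : ℝ} (hF : ∀ n, F ≤ A.tower.prob fun g => 0 < fixCount n g.1) {R : ℕ} (hR : 0 < R) (k : ℕ) :
    F - (R : ℝ)⁻¹ ≤ A.tower.prob (FewFixed H R k) := by
  have hlim : Tendsto (fun n => (R : ℝ)⁻¹ + (A.tower.prob (FewFixed H R k) +
      ∑ _q : A.group ⧸ A.tower.K k, ∑ j : Fin (k + 1), R * A.tower.prob (fun g =>
        fixCount n g.1 ≤ R ∧ fixCount (n + j) g.1 ≠ fixCount n g.1))) atTop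
      (nhds ((R : ℝ)⁻¹ + (A.tower.prob (FewFixed H R k) +
        ∑ _q : A.group ⧸ A.tower.K k, ∑ _j : Fin (k + 1), (R : ℝ) * 0))) :=
    ((tendsto_finsetSum _ fun q _ => tendsto_finsetSum _ fun (j : Fin (k + 1)) _ =>
      (hH.tendsto_prob_fixCount_ne j R).const_mul _).const_add _).const_add _
  have := ge_of_tendsto' hlim fun n => (hF n).trans (hH.prob_fixCount_pos_le hA hR k n)
  simp only [mul_zero, Finset.sum_const_zero, add_zero] at this
  linarith

/-- Right multiplication by an element with trivial restriction at a fixed vertex nearly preserves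
the cosets with few fixed points: up to level `m - n` it does not change the restrictions at this
vertex, of level `n`. -/
theorem prob_fewFixed_and_not_le [DecidableEq X] [Nonempty X] (hA : A.IsPolynomialLike) {R m : ℕ}
    {w : List X} (hm : w.length ≤ m) {g : A.group} (hw : g.1.1 w = w) (hg : restrict g.1 w = 1) :
    A.tower.prob (fun h => FewFixed H R m h ∧ ¬FewFixed H R m (h * g)) ≤
      A.tower.prob (FewFixed H R (m - w.length)) - A.tower.prob (FewFixed H R m) := by
  have hY := locConst_fewFixed H R m
  have hY' := locConst_fewFixed H R (m - w.length)
  have hYg := hY.mul_right g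
  have hd : (0 : ℝ) < (Fintype.card X : ℝ) ^ w.length := by
    have : 0 < Fintype.card X := Fintype.card_pos
    positivity
  have hfix : ∀ h : A.group, (h * g).1.1 w = h.1.1 w := by
    intro h
    change h.1.1 (g.1.1 w) = _
    rw [hw]
  have hres : ∀ h : A.group, A.res w (h * g) = A.res w h := by
    intro h
    rw [res_mul, hw, show A.res w g = 1 from Subtype.ext hg, mul_one]
  have hinv : ∀ h, ∀ s ∈ H, ind (FewFixed H R m (h * s) ∧ ¬FewFixed H R m (h * s * g)) =
      ind (FewFixed H R m h ∧ ¬FewFixed H R m (h * g)) := by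
    intro h s hs
    have hs' := hH.normal.conj_mem s hs g⁻¹
    rw [inv_inv] at hs'
    rw [show h * s * g = h * g * (g⁻¹ * s * g) by group, fewFixed_mul_right hs, fewFixed_mul_right hs']
  have h1 := hH.mean_ind_fixed_mul (hY.and hYg.not).ind hinv w
  have h2 := hH.mean_ind_fixed_mul hY.ind (fun h s hs => by rw [fewFixed_mul_right hs]) w
  have h3 := hA.prob_fixed_res hY' w
  have hE : A.tower.LocConst fun h => ind (h.1.1 w = w) * ind (FewFixed H R m h) :=
    (locConst_apply_eq w w).ind.mul hY.ind
  have h4 := mean_mul_right hE g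
  simp only [hfix] at h4
  have hEg : A.tower.LocConst fun h => ind (h.1.1 w = w) * ind (FewFixed H R m (h * g)) :=
    (locConst_apply_eq w w).ind.mul hYg.ind
  have hE' : A.tower.LocConst fun h => h.1.1 w = w ∧ FewFixed H R (m - w.length) (A.res w h) :=
    (locConst_apply_eq w w).and (hY'.comp_res w)
  have h5 := mean_mono ((locConst_apply_eq w w).ind.mul (hY.and hYg.not).ind) (hE'.ind.sub hEg) <| by
    intro h
    by_cases hhw : h.1.1 w = w
    · have hsub : ∀ h' : A.group, FewFixed H R m h' → h'.1.1 w = w →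
          FewFixed H R (m - w.length) (A.res w h') := fun h' hh' hw' =>
        hH.fewFixed_res (by rwa [Nat.add_sub_cancel' hm]) hw'
      rw [ind_of hhw, one_mul, one_mul]
      by_cases hb : FewFixed H R m (h * g)
      · rw [ind_of_not (fun h' => h'.2 hb), ind_of hb, ind_of, sub_self]
        exact ⟨hhw, hres h ▸ hsub _ hb ((hfix h).trans hhw)⟩
      · rw [ind_of_not hb, sub_zero]
        exact ind_mono fun h' => ⟨hhw, hsub h h'.1 hhw⟩
    · simp [ind_of_not hhw, ind_nonneg]
  rw [mean_sub hE'.ind hEg, h4] at h5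
  have h6 := mul_le_mul_of_nonneg_left h5 hd.le
  rw [h1, mul_sub, h2] at h6
  refine h6.trans (sub_le_sub_right (le_of_eq ?_) _)
  rw [← prob, h3, mul_inv_cancel_left₀ hd.ne']

end IsSelfReplicatingNormal

end InvertibleAutomaton

/-! ### The proportion of elements with fixed vertices -/

theorem natCard_subtype_eq_sum_ind {ι : Type*} [Fintype ι] (p : ι → Prop) :
    (Nat.card {i // p i} : ℝ) = ∑ i, ind (p i) := by
  classical
  rw [Nat.card_eq_fintype_card, Fintype.card_subtype, Finset.card_filter, Nat.cast_sum]
  refine Finset.sum_congr rfl fun i _ => ?_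
  by_cases h : p i
  · simp [h, ind]
  · simp [h, ind]

namespace InvertibleAutomaton

open TreeAut NormalTower Filter

variable {S X : Type*} [Fintype X] {A : InvertibleAutomaton S X}

theorem fixedPointProportion_eq_prob (n : ℕ) :
    fixedPointProportion A.group n = A.tower.prob fun g => 0 < fixCount n g.1 := by
  let φ : A.group → A.group.map (levelAction X n) := fun g =>
    ⟨levelAction X n g.1, Subgroup.mem_map_of_mem _ g.2⟩
  have hφ : ∀ g h, φ g = φ h ↔ (g : A.group ⧸ A.tower.K n) = h := by
    intro g h
    rw [QuotientGroup.eq]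
    change _ ↔ levelAction X n (g.1⁻¹ * h.1) = 1
    rw [map_mul, map_inv, inv_mul_eq_one, Subtype.ext_iff]
  let e : A.group ⧸ A.tower.K n ≃ A.group.map (levelAction X n) :=
    Equiv.ofBijective (fun q => φ q.out) <| by
      constructor
      · intro q q' h
        have := (hφ _ _).1 h
        simpa using this
      · rintro ⟨_, g, hg, rfl⟩
        exact ⟨(⟨g, hg⟩ : A.group), (hφ _ _).2 (QuotientGroup.out_eq' _)⟩
  have hp : ∀ g, ∀ k ∈ A.tower.K n, ind (0 < fixCount n (g * k).1) = ind (0 < fixCount n g.1) :=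
    fun g k hk => by rw [fixCount_mul_of_mem_tower g hk]
  rw [prob, mean_eq_avg hp, avg, fixedPointProportion, ← Nat.card_congr e,
    ← natCard_subtype_eq_sum_ind fun q : A.group ⧸ A.tower.K n => 0 < fixCount n q.out.1]
  congr 2
  refine (Nat.card_congr (e.subtypeEquiv fun q => ?_)).symm
  rw [fixCount_pos_iff]
  exact exists_congr fun v => ⟨fun h => Subtype.ext h, fun h => congrArg Subtype.val h⟩

theorem prob_fixCount_pos_antitone :
    Antitone fun n => A.tower.prob fun g => 0 < fixCount n g.1 := by
  have hp : ∀ n, A.tower.LocConst fun g => 0 < fixCount n g.1 := fun n =>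
    (locConst_fixCount n).comp fun i => 0 < i
  refine antitone_nat_of_succ_le fun n => prob_mono (hp _) (hp _) fun g hg => ?_
  obtain ⟨v, hv⟩ := fixCount_pos_iff.1 hg
  refine fixCount_pos_iff.2 ⟨⟨v.1.take n, by simp [v.2]⟩, ?_⟩
  rw [← List.take_append_drop n v.1] at hv
  exact (fixed_of_append hv).1

/-- No positive lower bound for the proportion of the elements with fixed points exists: the
subgroup of the elements that asymptotically preserve the set of cosets with few fixed points is the
whole group. -/
theorem IsPolynomialLike.le_zero_of_forall_le_prob [Finite S] [DecidableEq X]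
    (hX : 2 ≤ Fintype.card X) (hA : A.IsPolynomialLike)
    (hends : ∀ a : A.NontrivialState, A.InReducedCycle a →
      TreeAut.fixedEnds (A.toAut a.1) = ∅ ∨ (TreeAut.fixedEnds (A.toAut a.1)).Infinite)
    {F : ℝ} (hF : ∀ n, F ≤ A.tower.prob fun g => 0 < fixCount n g.1) : F ≤ 0 := by
  have : Nonempty X := Fintype.card_pos_iff.1 (by omega)
  by_contra! hpos
  obtain ⟨R, hR⟩ := exists_nat_one_div_lt hpos
  obtain ⟨H, hn, htr, hlift, l, hl, o, hoH, hol⟩ := hA.exists_normal_transitive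
  have hH : IsSelfReplicatingNormal H := ⟨hn, htr, fun v s hs => by
    obtain ⟨t, ht, htv, hts⟩ := hlift v s hs
    exact ⟨t, ht, htv, Subtype.ext hts⟩⟩
  have hY := locConst_fewFixed (A := A) H (R + 1)
  have hanti : Antitone fun m => A.tower.prob (FewFixed H (R + 1) m) := fun m m' h =>
    prob_mono (hY _) (hY _) fun _ hg => hg.anti h
  have hlim := tendsto_atTop_ciInf hanti ⟨0, by
    rintro _ ⟨m, rfl⟩
    exact prob_nonneg (hY m)⟩
  have hfix : ∀ (g : A.group) (w : List X), g.1.1 w = w → restrict g.1 w = 1 →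
      g ∈ almostPreserving H (R + 1) := by
    intro g w hw hg
    have hdiff := (hlim.comp (tendsto_sub_atTop_nat w.length)).sub hlim
    rw [sub_self] at hdiff
    refine squeeze_zero' (Eventually.of_forall fun m =>
      prob_nonneg ((hY m).and ((hY m).mul_right _).not)) ?_ hdiff
    filter_upwards [eventually_ge_atTop w.length] with m hm
    exact hH.prob_fewFixed_and_not_le hA hm hw hg
  have hoI : o ∈ almostPreserving H (R + 1) := by
    have : ∀ m, A.tower.prob (fun h => FewFixed H (R + 1) m h ∧ ¬FewFixed H (R + 1) m (h * o)) = 0 := by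
      intro m
      rw [prob, ← mean_const (T := A.tower) 0]
      congr 1
      funext h
      exact ind_of_not fun hh => hh.2 ((fewFixed_mul_right hoH).2 hh.1)
    exact tendsto_const_nhds.congr fun m => (this m).symm
  have htop := hA.eq_top_of_forall_restrict_eq_one hends hfix hl hoI hol
  have := ge_of_tendsto' (tendsto_prob_fewFixed hX htop) fun m =>
    hH.sub_inv_le_prob_fewFixed hA hF R.succ_pos m
  rw [one_div] at hR
  push_cast at this
  linarith

end InvertibleAutomaton

theorem corollary6p7 {S X : Type*} [Finite S] [Fintype X] [DecidableEq X]
    (hX : 2 ≤ Fintype.card X) (A : InvertibleAutomaton S X) (hA : A.IsPolynomialLike)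
    (hends : ∀ a : A.NontrivialState, A.InReducedCycle a →
      TreeAut.fixedEnds (A.toAut a.1) = ∅ ∨ (TreeAut.fixedEnds (A.toAut a.1)).Infinite) :
    Filter.Tendsto (TreeAut.fixedPointProportion A.group) Filter.atTop (nhds 0) := by
  have hanti := InvertibleAutomaton.prob_fixCount_pos_antitone (A := A)
  have hnonneg : ∀ n, 0 ≤ A.tower.prob fun g => 0 < TreeAut.fixCount n g.1 := fun n =>
    NormalTower.prob_nonneg ((InvertibleAutomaton.locConst_fixCount n).comp fun i => 0 < i)
  have hbdd : BddBelow (Set.range fun n => A.tower.prob fun g => 0 < TreeAut.fixCount n g.1) :=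
    ⟨0, by rintro _ ⟨n, rfl⟩; exact hnonneg n⟩
  have hlim := tendsto_atTop_ciInf hanti hbdd
  rw [le_antisymm (hA.le_zero_of_forall_le_prob hX hends fun n => ciInf_le hbdd n)
    (le_ciInf hnonneg)] at hlim
  exact hlim.congr fun n => (InvertibleAutomaton.fixedPointProportion_eq_prob n).symm
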